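/- Let $L_2$ be the two-sorted language of second-order arithmetic (number variables, set variables, $0,1,+,\cdot,=,<,\in$), and let $\mathsf{WKL}_0$ be the axiom system in classical logic consisting of the basic axioms of arithmetic, the induction scheme for $\Sigma^0_1$ formulas, the comprehension scheme for $\Delta^0_1$ formulas (both schemes with number and set parameters), and weak König's lemma: every infinite tree $T\subseteq 2^{<\mathbb N}$ has a path. Then $\mathsf{WKL}_0$ proves the following statement. Let $(P,\preceq)$ be a partial order, that is, $P\subseteq\mathbb N$ and ${\preceq}\subseteq P\times P$ is reflexive, antisymmetric and transitive. Suppose that $P$ has countably many initial intervals, i.e. there is a sequence of sets $\{I_n : n\in\mathbb N\}$ (coded by a single set) such that every $I\subseteq P$ satisfying $(\forall x,y\in P)(x\preceq y\wedge y\in I\to x\in I)$ is equal to $I_n$ for some $n\in\mathbb N$. Then $P$ has no infinite antichain, i.e. there is no infinite set $D\subseteq P$ such that any two distinct elements $x,y$ of $D$ satisfy $x\not\preceq y$ and $y\not\preceq x$. -/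

import Mathlib

/-! Second-order arithmetic as a formal system: the two-sorted language `L₂`, classical natural
deduction for it, the axiom systems `RCA₀` and `WKL₀`, and the order-theoretic notions written as
formulas of `L₂`. -/

namespace SecondOrderArith

/-! ### The language

Number variables and set variables are two separate families of de Bruijn indices: a number
quantifier binds number index `0` and does not affect set indices, and conversely. -/

/-- Number terms of `L₂`: number variables, `0`, `1`, `+`, `·`. -/
inductive Tm : Type
  | var (i : ℕ) : Tm
  | zero : Tm
  | one : Tm
  | add (t s : Tm) : Tm
  | mul (t s : Tm) : Tm

/-- Formulas of `L₂`. The atomic formulas are `t = s`, `t < s` and `t ∈ X`, where `X` is a set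
variable; `allN` quantifies over numbers and `allS` over sets. The remaining connectives are the
usual classical abbreviations. -/
inductive Fm : Type
  | eq (t s : Tm) : Fm
  | lt (t s : Tm) : Fm
  | mem (t : Tm) (X : ℕ) : Fm
  | bot : Fm
  | imp (φ ψ : Fm) : Fm
  | allN (φ : Fm) : Fm
  | allS (φ : Fm) : Fm

def Fm.neg (φ : Fm) : Fm := .imp φ .bot

def Fm.and (φ ψ : Fm) : Fm := .neg (.imp φ (.neg ψ))

def Fm.or (φ ψ : Fm) : Fm := .imp (.neg φ) ψ

def Fm.iff (φ ψ : Fm) : Fm := .and (.imp φ ψ) (.imp ψ φ)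

def Fm.exN (φ : Fm) : Fm := .neg (.allN (.neg φ))

def Fm.exS (φ : Fm) : Fm := .neg (.allS (.neg φ))

/-! ### Substitution -/

/-- Simultaneous substitution of number terms for number variables. -/
def Tm.subst (σ : ℕ → Tm) : Tm → Tm
  | .var i => σ i
  | .zero => .zero
  | .one => .one
  | .add t s => .add (t.subst σ) (s.subst σ)
  | .mul t s => .mul (t.subst σ) (s.subst σ)

/-- `t.up k` is the term `t` read below `k` further number quantifiers. -/
def Tm.up (k : ℕ) (t : Tm) : Tm := t.subst fun i => .var (i + k)

/-- A number substitution, moved below a number quantifier. -/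
def liftN (σ : ℕ → Tm) : ℕ → Tm
  | 0 => .var 0
  | i + 1 => (σ i).up 1

/-- A renaming of set variables, moved below a set quantifier. -/
def liftS (ρ : ℕ → ℕ) : ℕ → ℕ
  | 0 => 0
  | i + 1 => ρ i + 1

/-- Simultaneous capture-free substitution of terms for number variables and of set variables for
set variables. -/
def Fm.subst : (ℕ → Tm) → (ℕ → ℕ) → Fm → Fm
  | σ, _, .eq t s => .eq (t.subst σ) (s.subst σ)
  | σ, _, .lt t s => .lt (t.subst σ) (s.subst σ)
  | σ, ρ, .mem t X => .mem (t.subst σ) (ρ X)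
  | _, _, .bot => .bot
  | σ, ρ, .imp φ ψ => .imp (φ.subst σ ρ) (ψ.subst σ ρ)
  | σ, ρ, .allN φ => .allN (φ.subst (liftN σ) ρ)
  | σ, ρ, .allS φ => .allS (φ.subst σ (liftS ρ))

/-- `φ` read below one further number quantifier. -/
def Fm.shiftN (φ : Fm) : Fm := φ.subst (fun i => .var (i + 1)) id

/-- `φ` read below one further set quantifier. -/
def Fm.shiftS (φ : Fm) : Fm := φ.subst .var (· + 1)

/-- Instantiate number variable `0` of `φ` by `t`, and lower the other number variables. -/
def Fm.instN (φ : Fm) (t : Tm) : Fm :=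
  φ.subst (fun i => Nat.casesOn i t .var) id

/-- Instantiate set variable `0` of `φ` by the set variable `X`, and lower the other set
variables. -/
def Fm.instS (φ : Fm) (X : ℕ) : Fm :=
  φ.subst .var (fun i => Nat.casesOn i X id)

/-- Replace number variable `0` by its successor, and keep all other variables. -/
def Fm.succ (φ : Fm) : Fm :=
  φ.subst (fun i => Nat.casesOn i (.add (.var 0) .one) (fun j => .var (j + 1))) id

/-! ### Provability -/

/-- Classical two-sorted natural deduction with equality. `Derives T Γ φ` says that `φ` is
derivable from the nonlogical axioms `T` and the open assumptions `Γ`. Free variables of the axioms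
in `T` are read as universally quantified: the eigenvariable conditions concern `Γ` only. -/
inductive Derives (T : Set Fm) : List Fm → Fm → Prop
  | ax {Γ : List Fm} {φ : Fm} : φ ∈ T → Derives T Γ φ
  | hyp {Γ : List Fm} {φ : Fm} : φ ∈ Γ → Derives T Γ φ
  | impI {Γ : List Fm} {φ ψ : Fm} : Derives T (φ :: Γ) ψ → Derives T Γ (.imp φ ψ)
  | impE {Γ : List Fm} {φ ψ : Fm} : Derives T Γ (.imp φ ψ) → Derives T Γ φ → Derives T Γ ψ
  | raa {Γ : List Fm} {φ : Fm} : Derives T (φ.neg :: Γ) .bot → Derives T Γ φ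
  | allNI {Γ : List Fm} {φ : Fm} : Derives T (Γ.map Fm.shiftN) φ → Derives T Γ (.allN φ)
  | allNE {Γ : List Fm} {φ : Fm} (t : Tm) : Derives T Γ (.allN φ) → Derives T Γ (φ.instN t)
  | allSI {Γ : List Fm} {φ : Fm} : Derives T (Γ.map Fm.shiftS) φ → Derives T Γ (.allS φ)
  | allSE {Γ : List Fm} {φ : Fm} (X : ℕ) : Derives T Γ (.allS φ) → Derives T Γ (φ.instS X)
  | eqRefl {Γ : List Fm} (t : Tm) : Derives T Γ (.eq t t)
  | eqSubst {Γ : List Fm} (φ : Fm) {t s : Tm} :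
      Derives T Γ (.eq t s) → Derives T Γ (φ.instN t) → Derives T Γ (φ.instN s)

/-- The axiom system `T` proves `φ`. -/
def Proves (T : Set Fm) (φ : Fm) : Prop := Derives T [] φ

section Formulas

local prefix:max "#" => Tm.var
local infixl:65 " ∔ " => Tm.add
local infixl:70 " ⬝ " => Tm.mul
local infix:50 " ≐ " => Fm.eq
local infix:50 " ≺ " => Fm.lt
local infix:50 " ε " => Fm.mem
local prefix:max "∼" => Fm.neg
local infixr:35 " ⋏ " => Fm.and
local infixr:30 " ⋎ " => Fm.or
local infixr:25 " ⟹ " => Fm.imp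
local infix:20 " ⭤ " => Fm.iff

open Fm

/-! ### `RCA₀` -/

/-- Formulas all of whose quantifiers are bounded number quantifiers `∀ n < t`, `∃ n < t`, where
`n` does not occur in `t`. -/
inductive IsBounded : Fm → Prop
  | eq (t s : Tm) : IsBounded (t ≐ s)
  | lt (t s : Tm) : IsBounded (t ≺ s)
  | mem (t : Tm) (X : ℕ) : IsBounded (t ε X)
  | bot : IsBounded .bot
  | imp {φ ψ : Fm} : IsBounded φ → IsBounded ψ → IsBounded (φ ⟹ ψ)
  | ballN (t : Tm) {φ : Fm} : IsBounded φ → IsBounded (allN (#0 ≺ t.up 1 ⟹ φ))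
  | bexN (t : Tm) {φ : Fm} : IsBounded φ → IsBounded (exN (#0 ≺ t.up 1 ⋏ φ))

/-- `Σ⁰₁` formulas. -/
def IsSigma01 (φ : Fm) : Prop := ∃ θ, IsBounded θ ∧ φ = exN θ

/-- `Π⁰₁` formulas. -/
def IsPi01 (φ : Fm) : Prop := ∃ θ, IsBounded θ ∧ φ = allN θ

/-- The basic axioms of second-order arithmetic. -/
def basicAxioms : Set Fm :=
  { allN ∼(#0 ∔ .one ≐ .zero),
    allN (allN (#1 ∔ .one ≐ #0 ∔ .one ⟹ #1 ≐ #0)),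
    allN (#0 ∔ .zero ≐ #0),
    allN (allN (#1 ∔ (#0 ∔ .one) ≐ (#1 ∔ #0) ∔ .one)),
    allN (#0 ⬝ .zero ≐ .zero),
    allN (allN (#1 ⬝ (#0 ∔ .one) ≐ #1 ⬝ #0 ∔ #1)),
    allN ∼(#0 ≺ .zero),
    allN (allN (#1 ≺ #0 ∔ .one ⭤ (#1 ≺ #0 ⋎ #1 ≐ #0))) }

/-- `(φ(0) ∧ ∀ n (φ(n) → φ(n + 1))) → ∀ n φ(n)`, for the number variable `0` of `φ`. -/
def inductionAxiom (φ : Fm) : Fm :=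
  φ.instN .zero ⋏ allN (φ ⟹ φ.succ) ⟹ allN φ

/-- `∀ n (φ(n) ↔ ψ(n)) → ∃ X ∀ n (n ∈ X ↔ φ(n))`, for the number variable `0` of `φ` and `ψ`;
the set variable `X` is not free in `φ`. -/
def comprehensionAxiom (φ ψ : Fm) : Fm :=
  allN (φ ⭤ ψ) ⟹ exS (allN (#0 ε 0 ⭤ φ.shiftS))

/-- `RCA₀`: the basic axioms, `Σ⁰₁` induction and `Δ⁰₁` comprehension, with number and set
parameters. -/
def RCA0 : Set Fm :=
  basicAxioms ∪ {χ | ∃ φ, IsSigma01 φ ∧ χ = inductionAxiom φ} ∪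
    {χ | ∃ φ ψ, IsSigma01 φ ∧ IsPi01 ψ ∧ χ = comprehensionAxiom φ ψ}

/-! ### Finite sequences and `WKL₀` -/

/-- The pairing function `(i, j) = (i + j)² + i`. -/
def pair (i j : Tm) : Tm := (i ∔ j) ⬝ (i ∔ j) ∔ i

/-- `a` divides `b`. -/
def dvd (a b : Tm) : Fm := exN (b.up 1 ≐ a.up 1 ⬝ #0)

/-- `s` is of the form `(k, (m, n))`. -/
def isTriple (s : Tm) : Fm :=
  exN (exN (exN (s.up 3 ≐ pair #2 (pair #1 #0))))

/-- `s = (k, (m, n))` where `i < k` and `m (i + 1) + 1` divides `n`: the number `i` is an element of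
the finite set represented by `s`. Every finite set is represented by some `s`. -/
def finMem (i s : Tm) : Fm :=
  exN (exN (exN (s.up 3 ≐ pair #2 (pair #1 #0) ⋏ i.up 3 ≺ #2 ⋏
    dvd (#1 ⬝ (i.up 3 ∔ .one) ∔ .one) #0)))

/-- `s` is the code of a finite set, that is, the least number that represents this set. -/
def isFinSetCode (s : Tm) : Fm :=
  isTriple s ⋏
    allN (#0 ≺ s.up 1 ⋏ isTriple #0 ⟹ ∼(allN (finMem #0 #1 ⭤ finMem #0 (s.up 2))))

/-- `s` codes a finite sequence of numbers: a finite set of pairs `(i, v)` that is the graph of a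
function with domain `{i : i < l}` for some `l`. -/
def isSeq (s : Tm) : Fm :=
  isFinSetCode s ⋏
  allN (finMem #0 (s.up 1) ⟹ exN (exN (#2 ≐ pair #1 #0))) ⋏
  allN (allN (allN (finMem (pair #2 #1) (s.up 3) ⋏ finMem (pair #2 #0) (s.up 3) ⟹ #1 ≐ #0))) ⋏
  exN (allN (#0 ≺ #1 ⭤ exN (finMem (pair #1 #0) (s.up 3))))

/-- `s ∈ 2^{<ℕ}`. -/
def isBinSeq (s : Tm) : Fm :=
  isSeq s ⋏ allN (allN (finMem (pair #1 #0) (s.up 2) ⟹ #0 ≐ .zero ⋎ #0 ≐ .one))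

/-- For finite sequences `s` and `t`: `s` is an initial segment of `t`. -/
def isInitialSegment (s t : Tm) : Fm :=
  allN (finMem #0 (s.up 1) ⟹ finMem #0 (t.up 1))

/-- The set `T` is a tree contained in `2^{<ℕ}`. -/
def isBinTree (T : ℕ) : Fm :=
  allN (#0 ε T ⟹ isBinSeq #0) ⋏
  allN (allN (#1 ε T ⋏ isBinSeq #0 ⋏ isInitialSegment #0 #1 ⟹ #0 ε T))

/-- The set `X` is infinite. -/
def isInfinite (X : ℕ) : Fm := allN (exN (#1 ≺ #0 ⋏ #0 ε X))

/-- The set `F` is (the graph of) a function from `ℕ` to `ℕ`. -/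
def isFunction (F : ℕ) : Fm :=
  allN (#0 ε F ⟹ exN (exN (#2 ≐ pair #1 #0))) ⋏
  allN (exN (pair #1 #0 ε F)) ⋏
  allN (allN (allN (pair #2 #1 ε F ⋏ pair #2 #0 ε F ⟹ #1 ≐ #0)))

/-- For a function `F`: the finite set `s` is the sequence `⟨F(0), …, F(n - 1)⟩`. -/
def isRestriction (F : ℕ) (n s : Tm) : Fm :=
  allN (finMem #0 (s.up 1) ⭤
    exN (exN (#1 ≺ n.up 3 ⋏ #2 ≐ pair #1 #0 ⋏ pair #1 #0 ε F)))

/-- `F` is a path in the tree `T`. -/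
def isPath (F T : ℕ) : Fm :=
  isFunction F ⋏ allN (exN (#0 ε T ⋏ isRestriction F #1 #0))

/-- Weak König's lemma: every infinite tree contained in `2^{<ℕ}` has a path. -/
def weakKonigLemma : Fm :=
  allS (isBinTree 0 ⋏ isInfinite 0 ⟹ exS (isPath 0 1))

/-- `WKL₀`: `RCA₀` together with weak König's lemma. -/
def WKL0 : Set Fm := RCA0 ∪ {weakKonigLemma}

/-! ### Partial orders

In this part `P` and `L` are set variables for the domain `P` of a partial order and for the
relation `⪯`, a set of pairs. -/

/-- `x ⪯ y`. -/
def le (L : ℕ) (x y : Tm) : Fm := pair x y ε L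

/-- `⪯ ⊆ P × P` is reflexive on `P`, antisymmetric and transitive. -/
def isPartialOrder (P L : ℕ) : Fm :=
  allN (#0 ε L ⟹ exN (exN (#1 ε P ⋏ #0 ε P ⋏ #2 ≐ pair #1 #0))) ⋏
  allN (#0 ε P ⟹ le L #0 #0) ⋏
  allN (allN (le L #1 #0 ⋏ le L #0 #1 ⟹ #1 ≐ #0)) ⋏
  allN (allN (allN (le L #2 #1 ⋏ le L #1 #0 ⟹ le L #2 #0)))

/-- `I ⊆ P`, and `x ⪯ y ∈ I` implies `x ∈ I` for all `x, y ∈ P`. -/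
def isInitialInterval (P L I : ℕ) : Fm :=
  allN (#0 ε I ⟹ #0 ε P) ⋏
  allN (allN (#1 ε P ⋏ #0 ε P ⋏ le L #1 #0 ⋏ #0 ε I ⟹ #1 ε I))

/-- There is a sequence of sets `{Iₙ : n ∈ ℕ}`, coded by a single set `Z` as
`Iₙ = {x : (x, n) ∈ Z}`, such that every initial interval of `P` is equal to some `Iₙ`. -/
def countablyManyInitialIntervals (P L : ℕ) : Fm :=
  exS (allS (isInitialInterval (P + 2) (L + 2) 0 ⟹
    exN (allN (#0 ε 0 ⭤ pair #0 #1 ε 1))))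

/-- `D ⊆ P`, and distinct elements of `D` are incomparable. -/
def isAntichain (P L D : ℕ) : Fm :=
  allN (#0 ε D ⟹ #0 ε P) ⋏
  allN (allN (#1 ε D ⋏ #0 ε D ⋏ ∼(#1 ≐ #0) ⟹ ∼(le L #1 #0 ⋎ le L #0 #1)))

/-- `P` has an infinite antichain. -/
def hasInfiniteAntichain (P L : ℕ) : Fm :=
  exS (isAntichain (P + 1) (L + 1) 0 ⋏ isInfinite 0)

/-- Every partial order with countably many initial intervals has no infinite antichains. -/
def countableIntervalsNoInfiniteAntichain : Fm :=
  allS (allS (isPartialOrder 1 0 ⋏ countablyManyInitialIntervals 1 0 ⟹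
    ∼(hasInfiniteAntichain 1 0)))

end Formulas

end SecondOrderArith

/-!
The formal system `WKL₀` is handled through its models. The calculus `Derives` is complete for
countable interpretations (`proves_of_models`, a Henkin construction in which the free variables
serve as constants), so it suffices to verify the statement in every countable model of `WKL₀`. Such
a model has a possibly nonstandard number sort `A.M` and a family `A.E` of subsets of it. Σ⁰₁
induction makes `A.M` a canonically ordered strictly ordered commutative semiring, and the scheme is
applied to predicates written in Lean: the predicate `Delta0` says that such a predicate is defined
by a bounded formula with parameters, and is closed under the obvious operations.

The combinatorial argument is a diagonalization. Let `D` be an infinite antichain and `Z` a sequence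
of sets that is claimed to contain all initial intervals. The counting function of `D` exists as a
set of the model (`exists_counting_function`), so there is a set `B` such that the `n`-th element of
`D` is in `B` if and only if it is not in the `n`-th set of `Z` (`exists_diagonal`). If some initial
interval `I` satisfies `I ∩ D = B ∩ D`, then it differs from every set of `Z`. The natural choice for
`I`, the downward closure of `B ∩ D`, is only `Σ⁰₁`. Since `D` is an antichain, the downward closures
of the finite parts of `B ∩ D` show that the tree of finite approximations to an interval with this
trace on `D` is infinite, and weak König's lemma yields `I` as a path (`exists_interval`).

Both the counting function and the tree need codes of finite sets in a nonstandard model. The number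
`(k, (m, n))` represents the set of all `i < k` for which `m (i + 1) + 1` divides `n`. Every bounded
set of the model has a code (`exists_isCode`), because the moduli `m (i + 1) + 1` are pairwise
coprime as soon as `m` is divisible by all positive numbers below `k`; this follows from an explicit
Bézout identity and needs no theory of primes.
-/

namespace SecondOrderArith

/-! ### Substitution calculus -/

theorem Tm.subst_subst (σ τ : ℕ → Tm) (t : Tm) :
    (t.subst σ).subst τ = t.subst fun i => (σ i).subst τ := by
  induction t <;> simp_all [Tm.subst]

theorem Tm.subst_var (t : Tm) : t.subst .var = t := by
  induction t <;> simp_all [Tm.subst]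

theorem liftN_var : liftN .var = .var := by
  funext i; cases i <;> rfl

theorem liftS_id : liftS id = id := by
  funext i; cases i <;> rfl

theorem Tm.up_subst_liftN (σ : ℕ → Tm) (t : Tm) :
    (t.up 1).subst (liftN σ) = (t.subst σ).up 1 := by
  simp only [Tm.up, Tm.subst_subst]
  rfl

theorem liftN_comp (σ τ : ℕ → Tm) :
    (fun i => (liftN σ i).subst (liftN τ)) = liftN fun i => (σ i).subst τ := by
  funext i
  cases i with
  | zero => rfl
  | succ i => exact Tm.up_subst_liftN τ (σ i)

theorem liftS_comp (ρ π : ℕ → ℕ) :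
    (fun i => liftS π (liftS ρ i)) = liftS fun i => π (ρ i) := by
  funext i; cases i <;> rfl

theorem Fm.subst_subst (φ : Fm) : ∀ (σ τ : ℕ → Tm) (ρ π : ℕ → ℕ),
    (φ.subst σ ρ).subst τ π = φ.subst (fun i => (σ i).subst τ) fun i => π (ρ i) := by
  induction φ with
  | allN φ ih => intro σ τ ρ π; simp only [Fm.subst, ih, liftN_comp]
  | allS φ ih => intro σ τ ρ π; simp only [Fm.subst, ih, liftS_comp]
  | _ => simp_all [Fm.subst, Tm.subst_subst]

theorem Fm.subst_id (φ : Fm) : φ.subst .var id = φ := by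
  induction φ with
  | allN φ ih => simp only [Fm.subst, liftN_var, ih]
  | allS φ ih => simp only [Fm.subst, liftS_id, ih]
  | _ => simp_all [Fm.subst, Tm.subst_var]

theorem Fm.shiftN_subst (φ : Fm) (σ : ℕ → Tm) (ρ : ℕ → ℕ) :
    φ.shiftN.subst (liftN σ) ρ = (φ.subst σ ρ).shiftN := by
  simp only [Fm.shiftN, Fm.subst_subst]
  rfl

theorem Fm.shiftS_subst (φ : Fm) (σ : ℕ → Tm) (ρ : ℕ → ℕ) :
    φ.shiftS.subst σ (liftS ρ) = (φ.subst σ ρ).shiftS := by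
  simp only [Fm.shiftS, Fm.subst_subst, Tm.subst_var]
  rfl

theorem Tm.up_one_subst (t : Tm) {σ : ℕ → Tm} (h : ∀ i, σ (i + 1) = .var i) :
    (t.up 1).subst σ = t := by
  simp only [Tm.up, Tm.subst_subst, Tm.subst, h]
  exact t.subst_var

theorem Fm.instN_subst (φ : Fm) (t : Tm) (σ : ℕ → Tm) (ρ : ℕ → ℕ) :
    (φ.instN t).subst σ ρ = (φ.subst (liftN σ) ρ).instN (t.subst σ) := by
  simp only [Fm.instN, Fm.subst_subst]
  congr 1
  funext i
  cases i with
  | zero => rfl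
  | succ i => exact ((σ i).up_one_subst fun _ => rfl).symm

theorem Fm.instS_subst (φ : Fm) (X : ℕ) (σ : ℕ → Tm) (ρ : ℕ → ℕ) :
    (φ.instS X).subst σ ρ = (φ.subst σ (liftS ρ)).instS (ρ X) := by
  simp only [Fm.instS, Fm.subst_subst, Tm.subst_var]
  congr 1
  funext i
  cases i <;> rfl

theorem Fm.succ_subst (φ : Fm) (σ : ℕ → Tm) (ρ : ℕ → ℕ) :
    φ.succ.subst (liftN σ) ρ = (φ.subst (liftN σ) ρ).succ := by
  simp only [Fm.succ, Fm.subst_subst]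
  congr 1
  funext i
  cases i with
  | zero => rfl
  | succ i =>
    simp only [liftN, Tm.up, Tm.subst_subst]
    rfl

/-- All free number variables of `φ` are below `n`, expressed by the effect of substitutions. -/
def Fm.NumBelow (n : ℕ) (φ : Fm) : Prop :=
  ∀ σ τ ρ, (∀ i < n, σ i = τ i) → φ.subst σ ρ = φ.subst τ ρ

/-- All free set variables of `φ` are below `n`, expressed by the effect of substitutions. -/
def Fm.SetBelow (n : ℕ) (φ : Fm) : Prop :=
  ∀ σ ρ π, (∀ i < n, ρ i = π i) → φ.subst σ ρ = φ.subst σ π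

theorem Tm.exists_numBelow (t : Tm) :
    ∃ n, ∀ m ≥ n, ∀ σ τ : ℕ → Tm, (∀ i < m, σ i = τ i) → t.subst σ = t.subst τ := by
  induction t with
  | var i => exact ⟨i + 1, fun m hm σ τ h => h i hm⟩
  | zero => exact ⟨0, fun m hm σ τ h => rfl⟩
  | one => exact ⟨0, fun m hm σ τ h => rfl⟩
  | add t s iht ihs =>
    obtain ⟨a, ha⟩ := iht
    obtain ⟨b, hb⟩ := ihs
    refine ⟨max a b, fun m hm σ τ h => ?_⟩
    simp only [Tm.subst, ha m (by omega) σ τ h, hb m (by omega) σ τ h]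
  | mul t s iht ihs =>
    obtain ⟨a, ha⟩ := iht
    obtain ⟨b, hb⟩ := ihs
    refine ⟨max a b, fun m hm σ τ h => ?_⟩
    simp only [Tm.subst, ha m (by omega) σ τ h, hb m (by omega) σ τ h]

theorem liftN_congr {n : ℕ} {σ τ : ℕ → Tm} (h : ∀ i < n, σ i = τ i) :
    ∀ i < n, liftN σ i = liftN τ i := by
  rintro (_ | i) hi
  · rfl
  · exact congrArg (Tm.up 1) (h i (by omega))

theorem liftS_congr {n : ℕ} {ρ π : ℕ → ℕ} (h : ∀ i < n, ρ i = π i) :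
    ∀ i < n, liftS ρ i = liftS π i := by
  rintro (_ | i) hi
  · rfl
  · exact congrArg (· + 1) (h i (by omega))

theorem Fm.exists_numBelow (φ : Fm) : ∃ n, ∀ m ≥ n, φ.NumBelow m := by
  induction φ with
  | eq t s =>
    obtain ⟨a, ha⟩ := t.exists_numBelow
    obtain ⟨b, hb⟩ := s.exists_numBelow
    refine ⟨max a b, fun m hm σ τ ρ h => ?_⟩
    simp only [Fm.subst, ha m (by omega) σ τ h, hb m (by omega) σ τ h]
  | lt t s =>
    obtain ⟨a, ha⟩ := t.exists_numBelow
    obtain ⟨b, hb⟩ := s.exists_numBelow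
    refine ⟨max a b, fun m hm σ τ ρ h => ?_⟩
    simp only [Fm.subst, ha m (by omega) σ τ h, hb m (by omega) σ τ h]
  | mem t X =>
    obtain ⟨a, ha⟩ := t.exists_numBelow
    refine ⟨a, fun m hm σ τ ρ h => ?_⟩
    simp only [Fm.subst, ha m hm σ τ h]
  | bot => exact ⟨0, fun m hm σ τ ρ h => rfl⟩
  | imp φ ψ ih₁ ih₂ =>
    obtain ⟨a, ha⟩ := ih₁
    obtain ⟨b, hb⟩ := ih₂
    refine ⟨max a b, fun m hm σ τ ρ h => ?_⟩
    simp only [Fm.subst, ha m (by omega) σ τ ρ h, hb m (by omega) σ τ ρ h]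
  | allN φ ih =>
    obtain ⟨a, ha⟩ := ih
    exact ⟨a, fun m hm σ τ ρ h => congrArg Fm.allN (ha m hm _ _ ρ (liftN_congr h))⟩
  | allS φ ih =>
    obtain ⟨a, ha⟩ := ih
    exact ⟨a, fun m hm σ τ ρ h => congrArg Fm.allS (ha m hm _ _ _ h)⟩

theorem Fm.exists_setBelow (φ : Fm) : ∃ n, ∀ m ≥ n, φ.SetBelow m := by
  induction φ with
  | eq t s => exact ⟨0, fun m hm σ ρ π h => rfl⟩
  | lt t s => exact ⟨0, fun m hm σ ρ π h => rfl⟩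
  | mem t X =>
    exact ⟨X + 1, fun m hm σ ρ π h => by simp only [Fm.subst, h X (by omega)]⟩
  | bot => exact ⟨0, fun m hm σ ρ π h => rfl⟩
  | imp φ ψ ih₁ ih₂ =>
    obtain ⟨a, ha⟩ := ih₁
    obtain ⟨b, hb⟩ := ih₂
    refine ⟨max a b, fun m hm σ ρ π h => ?_⟩
    simp only [Fm.subst, ha m (by omega) σ ρ π h, hb m (by omega) σ ρ π h]
  | allN φ ih =>
    obtain ⟨a, ha⟩ := ih
    exact ⟨a, fun m hm σ ρ π h => congrArg Fm.allN (ha m hm _ _ _ h)⟩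
  | allS φ ih =>
    obtain ⟨a, ha⟩ := ih
    exact ⟨a, fun m hm σ ρ π h => congrArg Fm.allS (ha m hm _ _ _ (liftS_congr h))⟩

theorem exists_numBelow_list (Γ : List Fm) : ∃ n, ∀ m ≥ n, ∀ φ ∈ Γ, φ.NumBelow m := by
  induction Γ with
  | nil => exact ⟨0, by simp⟩
  | cons φ Γ ih =>
    obtain ⟨a, ha⟩ := ih
    obtain ⟨b, hb⟩ := φ.exists_numBelow
    refine ⟨max a b, fun m hm ψ hψ => ?_⟩
    rcases List.mem_cons.1 hψ with rfl | hψ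
    · exact hb m (by omega)
    · exact ha m (by omega) ψ hψ

theorem exists_setBelow_list (Γ : List Fm) : ∃ n, ∀ m ≥ n, ∀ φ ∈ Γ, φ.SetBelow m := by
  induction Γ with
  | nil => exact ⟨0, by simp⟩
  | cons φ Γ ih =>
    obtain ⟨a, ha⟩ := ih
    obtain ⟨b, hb⟩ := φ.exists_setBelow
    refine ⟨max a b, fun m hm ψ hψ => ?_⟩
    rcases List.mem_cons.1 hψ with rfl | hψ
    · exact hb m (by omega)
    · exact ha m (by omega) ψ hψ

/-! ### Derivations from a theory closed under substitution -/

/-- `T` contains every substitution instance of its members. -/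
def SubstClosed (T : Set Fm) : Prop := ∀ φ ∈ T, ∀ σ ρ, φ.subst σ ρ ∈ T

/-- Substitution and weakening, proved together. -/
theorem Derives.subst {T : Set Fm} (hT : SubstClosed T) {Γ : List Fm} {φ : Fm}
    (h : Derives T Γ φ) : ∀ (σ : ℕ → Tm) (ρ : ℕ → ℕ) (Δ : List Fm),
      (∀ ψ ∈ Γ, ψ.subst σ ρ ∈ Δ) → Derives T Δ (φ.subst σ ρ) := by
  induction h with
  | ax h => exact fun σ ρ Δ _ => .ax (hT _ h σ ρ)
  | hyp h => exact fun σ ρ Δ hΔ => .hyp (hΔ _ h)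
  | impI _ ih =>
    intro σ ρ Δ hΔ
    refine .impI (ih σ ρ _ fun ψ hψ => ?_)
    rcases List.mem_cons.1 hψ with rfl | hψ
    · exact List.mem_cons_self
    · exact List.mem_cons_of_mem _ (hΔ _ hψ)
  | impE _ _ ih₁ ih₂ => exact fun σ ρ Δ hΔ => .impE (ih₁ σ ρ Δ hΔ) (ih₂ σ ρ Δ hΔ)
  | raa _ ih =>
    intro σ ρ Δ hΔ
    refine .raa (ih σ ρ _ fun ψ hψ => ?_)
    rcases List.mem_cons.1 hψ with rfl | hψ
    · exact List.mem_cons_self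
    · exact List.mem_cons_of_mem _ (hΔ _ hψ)
  | allNI _ ih =>
    intro σ ρ Δ hΔ
    refine .allNI (ih (liftN σ) ρ _ fun ψ hψ => ?_)
    obtain ⟨χ, hχ, rfl⟩ := List.mem_map.1 hψ
    rw [Fm.shiftN_subst]
    exact List.mem_map_of_mem (hΔ _ hχ)
  | allNE t _ ih =>
    intro σ ρ Δ hΔ
    rw [Fm.instN_subst]
    exact .allNE _ (ih σ ρ Δ hΔ)
  | allSI _ ih =>
    intro σ ρ Δ hΔ
    refine .allSI (ih σ (liftS ρ) _ fun ψ hψ => ?_)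
    obtain ⟨χ, hχ, rfl⟩ := List.mem_map.1 hψ
    rw [Fm.shiftS_subst]
    exact List.mem_map_of_mem (hΔ _ hχ)
  | allSE X _ ih =>
    intro σ ρ Δ hΔ
    rw [Fm.instS_subst]
    exact .allSE _ (ih σ ρ Δ hΔ)
  | eqRefl t => exact fun σ ρ Δ _ => .eqRefl _
  | eqSubst φ _ _ ih₁ ih₂ =>
    intro σ ρ Δ hΔ
    have h₁ := ih₁ σ ρ Δ hΔ
    have h₂ := ih₂ σ ρ Δ hΔ
    rw [Fm.instN_subst] at h₂ ⊢
    exact .eqSubst _ h₁ h₂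

theorem Derives.weaken {T : Set Fm} (hT : SubstClosed T) {Γ Δ : List Fm} {φ : Fm}
    (h : Derives T Γ φ) (hΔ : Γ ⊆ Δ) : Derives T Δ φ := by
  have := h.subst hT .var id Δ fun ψ hψ => by rw [Fm.subst_id]; exact hΔ hψ
  rwa [Fm.subst_id] at this

/-- Generalization on a fresh number variable. -/
theorem Derives.exists_fresh_num {T : Set Fm} (hT : SubstClosed T) (Γ : List Fm) (φ : Fm) :
    ∃ k, Derives T Γ (φ.instN (.var k)) → Derives T Γ (.allN φ) := by
  obtain ⟨k, hk⟩ := exists_numBelow_list (φ :: Γ)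
  have hk := hk k le_rfl
  refine ⟨k, fun h => .allNI ?_⟩
  -- The renaming that turns the fresh variable `k` into the variable `0` and shifts the others.
  let τ : ℕ → Tm := fun i => if i = k then .var 0 else .var (i + 1)
  have h' := h.subst hT τ id (Γ.map Fm.shiftN) fun ψ hψ => by
    refine List.mem_map.2 ⟨ψ, hψ, hk ψ (List.mem_cons_of_mem _ hψ) _ _ _ fun i hi => ?_⟩
    simp [τ, hi.ne]
  rw [Fm.instN, Fm.subst_subst] at h'
  convert h' using 1
  refine (Fm.subst_id φ).symm.trans (hk φ List.mem_cons_self _ _ _ fun i hi => ?_)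
  rcases i with _ | i
  · simp [Tm.subst, τ]
  · simp [Tm.subst, τ, show i ≠ k by omega]

/-- Generalization on a fresh set variable. -/
theorem Derives.exists_fresh_set {T : Set Fm} (hT : SubstClosed T) (Γ : List Fm) (φ : Fm) :
    ∃ k, Derives T Γ (φ.instS k) → Derives T Γ (.allS φ) := by
  obtain ⟨k, hk⟩ := exists_setBelow_list (φ :: Γ)
  have hk := hk k le_rfl
  refine ⟨k, fun h => .allSI ?_⟩
  let τ : ℕ → ℕ := fun i => if i = k then 0 else i + 1
  have h' := h.subst hT .var τ (Γ.map Fm.shiftS) fun ψ hψ => by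
    refine List.mem_map.2 ⟨ψ, hψ, hk ψ (List.mem_cons_of_mem _ hψ) _ _ _ fun i hi => ?_⟩
    simp [τ, hi.ne]
  rw [Fm.instS, Fm.subst_subst] at h'
  convert h' using 1
  refine (Fm.subst_id φ).symm.trans (hk φ List.mem_cons_self _ _ _ fun i hi => ?_)
  rcases i with _ | i
  · simp [τ]
  · simp [τ, show i ≠ k by omega]

/-! ### Semantics -/

/-- Put `a` in front of the assignment `v`. -/
def push {α : Type} (a : α) (v : ℕ → α) : ℕ → α
  | 0 => a
  | i + 1 => v i

/-- An interpretation of `L₂`. The set sort is a countable family `E` of subsets of the number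
sort, and set variables take values in the index set `ℕ` of that family. -/
structure Interp where
  /-- The domain of the number sort. -/
  M : Type
  zero : M
  one : M
  add : M → M → M
  mul : M → M → M
  lt : M → M → Prop
  /-- The sets of the interpretation. -/
  E : ℕ → Set M

section Semantics

variable (A : Interp)

/-- The value of a term under an assignment. -/
def Tm.val (v : ℕ → A.M) : Tm → A.M
  | .var i => v i
  | .zero => A.zero
  | .one => A.one
  | .add t s => A.add (t.val v) (s.val v)
  | .mul t s => A.mul (t.val v) (s.val v)

/-- Truth of a formula under an assignment of numbers and of indices of sets. -/
def Fm.Sat : (ℕ → A.M) → (ℕ → ℕ) → Fm → Prop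
  | v, _, .eq t s => t.val A v = s.val A v
  | v, _, .lt t s => A.lt (t.val A v) (s.val A v)
  | v, ρ, .mem t X => t.val A v ∈ A.E (ρ X)
  | _, _, .bot => False
  | v, ρ, .imp φ ψ => φ.Sat v ρ → ψ.Sat v ρ
  | v, ρ, .allN φ => ∀ a, φ.Sat (push a v) ρ
  | v, ρ, .allS φ => ∀ X, φ.Sat v (push X ρ)

theorem Tm.val_subst (v : ℕ → A.M) (σ : ℕ → Tm) (t : Tm) :
    (t.subst σ).val A v = t.val A fun i => (σ i).val A v := by
  induction t <;> simp_all [Tm.subst, Tm.val]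

theorem Tm.val_up_one (v : ℕ → A.M) (a : A.M) (t : Tm) :
    (t.up 1).val A (push a v) = t.val A v :=
  t.val_subst A (push a v) _

theorem Fm.sat_subst (φ : Fm) : ∀ (v : ℕ → A.M) (ρ : ℕ → ℕ) (σ : ℕ → Tm) (π : ℕ → ℕ),
    (φ.subst σ π).Sat A v ρ ↔ φ.Sat A (fun i => (σ i).val A v) fun i => ρ (π i) := by
  induction φ with
  | eq t s => intros; simp only [Fm.subst, Fm.Sat, Tm.val_subst]
  | lt t s => intros; simp only [Fm.subst, Fm.Sat, Tm.val_subst]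
  | mem t X => intros; simp only [Fm.subst, Fm.Sat, Tm.val_subst]
  | bot => intros; rfl
  | imp φ ψ ih₁ ih₂ => intros; simp only [Fm.subst, Fm.Sat, ih₁, ih₂]
  | allN φ ih =>
    intro v ρ σ π
    simp only [Fm.subst, Fm.Sat, ih]
    refine forall_congr' fun a => iff_of_eq (congrArg (fun w => φ.Sat A w _) ?_)
    funext i
    cases i with
    | zero => rfl
    | succ i => exact (σ i).val_up_one A v a
  | allS φ ih =>
    intro v ρ σ π
    simp only [Fm.subst, Fm.Sat, ih]
    refine forall_congr' fun a => iff_of_eq (congrArg (fun w => φ.Sat A _ w) ?_)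
    funext i
    cases i <;> rfl

theorem Fm.sat_instN (φ : Fm) (t : Tm) (v : ℕ → A.M) (ρ : ℕ → ℕ) :
    (φ.instN t).Sat A v ρ ↔ φ.Sat A (push (t.val A v) v) ρ := by
  rw [Fm.instN, Fm.sat_subst]
  refine iff_of_eq (congrArg (fun w => φ.Sat A w _) ?_)
  funext i
  cases i <;> rfl

theorem Fm.sat_instS (φ : Fm) (X : ℕ) (v : ℕ → A.M) (ρ : ℕ → ℕ) :
    (φ.instS X).Sat A v ρ ↔ φ.Sat A v (push (ρ X) ρ) := by
  rw [Fm.instS, Fm.sat_subst]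
  refine iff_of_eq (congrArg (fun w => φ.Sat A _ w) ?_)
  funext i
  cases i <;> rfl

theorem Fm.sat_succ (φ : Fm) (a : A.M) (v : ℕ → A.M) (ρ : ℕ → ℕ) :
    φ.succ.Sat A (push a v) ρ ↔ φ.Sat A (push (A.add a A.one) v) ρ := by
  rw [Fm.succ, Fm.sat_subst]
  refine iff_of_eq (congrArg (fun w => φ.Sat A w _) ?_)
  funext i
  cases i <;> rfl

theorem Fm.sat_shiftS (φ : Fm) (X : ℕ) (v : ℕ → A.M) (ρ : ℕ → ℕ) :
    φ.shiftS.Sat A v (push X ρ) ↔ φ.Sat A v ρ :=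
  φ.sat_subst A v _ _ _

end Semantics

/-! ### The completeness theorem -/

section Completeness

/-- An injective numbering of terms. -/
def Tm.code : Tm → ℕ
  | .var i => Nat.pair 0 i
  | .zero => Nat.pair 1 0
  | .one => Nat.pair 2 0
  | .add t s => Nat.pair 3 (Nat.pair t.code s.code)
  | .mul t s => Nat.pair 4 (Nat.pair t.code s.code)

/-- An injective numbering of formulas. -/
def Fm.code : Fm → ℕ
  | .eq t s => Nat.pair 0 (Nat.pair t.code s.code)
  | .lt t s => Nat.pair 1 (Nat.pair t.code s.code)
  | .mem t X => Nat.pair 2 (Nat.pair t.code X)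
  | .bot => Nat.pair 3 0
  | .imp φ ψ => Nat.pair 4 (Nat.pair φ.code ψ.code)
  | .allN φ => Nat.pair 5 φ.code
  | .allS φ => Nat.pair 6 φ.code

theorem Tm.code_injective : Function.Injective Tm.code := by
  intro t
  induction t with
  | add t s iht ihs =>
    intro r h
    cases r <;> simp [Tm.code, Nat.pair_eq_pair] at h
    rw [iht h.1, ihs h.2]
  | mul t s iht ihs =>
    intro r h
    cases r <;> simp [Tm.code, Nat.pair_eq_pair] at h
    rw [iht h.1, ihs h.2]
  | _ => intro r h; cases r <;> simp_all [Tm.code, Nat.pair_eq_pair]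

theorem Fm.code_injective : Function.Injective Fm.code := by
  intro φ
  induction φ with
  | imp φ ψ ih₁ ih₂ =>
    intro χ h
    cases χ <;> simp [Fm.code, Nat.pair_eq_pair] at h
    rw [ih₁ h.1, ih₂ h.2]
  | allN φ ih =>
    intro χ h
    cases χ <;> simp [Fm.code, Nat.pair_eq_pair] at h
    rw [ih h]
  | allS φ ih =>
    intro χ h
    cases χ <;> simp [Fm.code, Nat.pair_eq_pair] at h
    rw [ih h]
  | _ =>
    intro χ h
    cases χ <;> simp_all [Fm.code, Nat.pair_eq_pair, Tm.code_injective.eq_iff]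

instance : Countable Tm := Tm.code_injective.countable

instance : Countable Fm := Fm.code_injective.countable

variable {T : Set Fm}

/-- One step of the Henkin construction: decide `ψ`, and if `ψ` is a universal formula that gets
refuted, add a counterexample. -/
theorem exists_henkin_step (hT : SubstClosed T) (Γ : List Fm) (hΓ : ¬Derives T Γ .bot) (ψ : Fm) :
    ∃ Δ, ¬Derives T Δ .bot ∧ Γ ⊆ Δ ∧ (ψ ∈ Δ ∨ ψ.neg ∈ Δ) ∧
      (∀ χ, ψ = .allN χ → ψ ∈ Δ ∨ ∃ t, (χ.instN t).neg ∈ Δ) ∧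
      (∀ χ, ψ = .allS χ → ψ ∈ Δ ∨ ∃ X, (χ.instS X).neg ∈ Δ) := by
  by_cases hψ : Derives T (ψ :: Γ) .bot
  · have hneg : Derives T Γ ψ.neg := .impI hψ
    have hcons : ¬Derives T (ψ.neg :: Γ) .bot := fun h => hΓ (.impE hneg (.raa h))
    -- A formula from which `ψ` follows may be refuted along with `ψ`.
    have key : ∀ θ, (Derives T (ψ.neg :: Γ) θ → Derives T (ψ.neg :: Γ) ψ) →
        ¬Derives T (θ.neg :: ψ.neg :: Γ) .bot := fun θ hθ h =>
      hcons (.impE (.hyp List.mem_cons_self) (hθ (.raa h)))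
    cases ψ with
    | allN χ =>
      obtain ⟨k, hk⟩ := Derives.exists_fresh_num hT (Fm.neg (.allN χ) :: Γ) χ
      refine ⟨_, key _ hk, ?_, .inr (by simp), ?_, by simp⟩
      · intro θ hθ; simp [hθ]
      · rintro _ ⟨⟩
        exact .inr ⟨_, List.mem_cons_self⟩
    | allS χ =>
      obtain ⟨k, hk⟩ := Derives.exists_fresh_set hT (Fm.neg (.allS χ) :: Γ) χ
      refine ⟨_, key _ hk, ?_, .inr (by simp), by simp, ?_⟩
      · intro θ hθ; simp [hθ]
      · rintro _ ⟨⟩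
        exact .inr ⟨_, List.mem_cons_self⟩
    | _ => exact ⟨_, hcons, fun θ hθ => by simp [hθ], .inr (by simp), by simp, by simp⟩
  · exact ⟨ψ :: Γ, hψ, fun θ hθ => by simp [hθ], .inl (by simp), by simp, by simp⟩

/-- A maximal consistent set of formulas in which every refuted universal formula has a
counterexample. -/
structure IsHenkin (T : Set Fm) (H : Set Fm) : Prop where
  consistent : ∀ Γ : List Fm, (∀ φ ∈ Γ, φ ∈ H) → ¬Derives T Γ .bot
  complete : ∀ φ, φ ∈ H ∨ φ.neg ∈ H
  allN : ∀ φ, Fm.allN φ ∈ H ∨ ∃ t, (φ.instN t).neg ∈ H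
  allS : ∀ φ, Fm.allS φ ∈ H ∨ ∃ X, (φ.instS X).neg ∈ H

theorem exists_isHenkin (hT : SubstClosed T) (Γ₀ : List Fm) (hΓ₀ : ¬Derives T Γ₀ .bot) :
    ∃ H, IsHenkin T H ∧ ∀ φ ∈ Γ₀, φ ∈ H := by
  have : Nonempty Fm := ⟨.bot⟩
  obtain ⟨e, he⟩ := exists_surjective_nat Fm
  choose step h₁ h₂ h₃ h₄ h₅ using exists_henkin_step hT
  let C := {Γ : List Fm // ¬Derives T Γ .bot}
  let G : ℕ → C := fun n =>
    Nat.rec (motive := fun _ => C) ⟨Γ₀, hΓ₀⟩ (fun n Γ => ⟨step Γ.1 Γ.2 (e n), h₁ _ _ _⟩) n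
  have hmono : ∀ {m n}, m ≤ n → (G m).1 ⊆ (G n).1 := by
    intro m n hmn
    induction hmn with
    | refl => exact fun _ => id
    | step _ ih => exact fun _ h => h₂ _ _ _ (ih h)
  have hstep : ∀ n, (G (n + 1)).1 = step (G n).1 (G n).2 (e n) := fun n => rfl
  refine ⟨{φ | ∃ n, φ ∈ (G n).1}, ⟨?_, ?_, ?_, ?_⟩, fun φ hφ => ⟨0, hφ⟩⟩
  · intro Γ hΓ h
    have : ∃ n, Γ ⊆ (G n).1 := by
      clear h
      induction Γ with
      | nil => exact ⟨0, by simp⟩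
      | cons φ Γ ih =>
        obtain ⟨m, hm⟩ := ih fun ψ hψ => hΓ ψ (by simp [hψ])
        obtain ⟨n, hn⟩ := hΓ φ (by simp)
        exact ⟨max m n, List.cons_subset.2 ⟨hmono (le_max_right m n) hn,
          fun ψ hψ => hmono (le_max_left m n) (hm hψ)⟩⟩
    obtain ⟨n, hn⟩ := this
    exact (G n).2 (h.weaken hT hn)
  · intro φ
    obtain ⟨n, rfl⟩ := he φ
    exact (h₃ _ (G n).2 (e n)).imp (fun h => ⟨n + 1, h⟩) fun h => ⟨n + 1, h⟩
  · intro φ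
    obtain ⟨n, hn⟩ := he (.allN φ)
    rw [← hn]
    exact (h₄ _ (G n).2 (e n) φ hn).imp (fun h => ⟨n + 1, h⟩) fun ⟨t, h⟩ => ⟨t, n + 1, h⟩
  · intro φ
    obtain ⟨n, hn⟩ := he (.allS φ)
    rw [← hn]
    exact (h₅ _ (G n).2 (e n) φ hn).imp (fun h => ⟨n + 1, h⟩) fun ⟨t, h⟩ => ⟨t, n + 1, h⟩

namespace IsHenkin

variable {H : Set Fm}

theorem mem_of_derives (hH : IsHenkin T H) (hT : SubstClosed T) {Γ : List Fm} {φ : Fm}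
    (hΓ : ∀ ψ ∈ Γ, ψ ∈ H) (h : Derives T Γ φ) : φ ∈ H := by
  refine (hH.complete φ).resolve_right fun hn => hH.consistent (φ.neg :: Γ) ?_ ?_
  · simpa using ⟨hn, hΓ⟩
  · exact .impE (.hyp List.mem_cons_self) (h.weaken hT fun ψ hψ => List.mem_cons_of_mem _ hψ)

theorem neg_mem (hH : IsHenkin T H) (φ : Fm) : φ.neg ∈ H ↔ φ ∉ H := by
  refine ⟨fun h h' => hH.consistent [φ.neg, φ] (by simp [h, h']) ?_, (hH.complete φ).resolve_left⟩
  exact .impE (φ := φ) (.hyp (by simp [Fm.neg])) (.hyp (by simp))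

theorem bot_not_mem (hH : IsHenkin T H) : Fm.bot ∉ H := fun h =>
  hH.consistent [.bot] (by simpa using h) (.hyp (by simp))

theorem imp_mem (hH : IsHenkin T H) (hT : SubstClosed T) (φ ψ : Fm) :
    Fm.imp φ ψ ∈ H ↔ (φ ∈ H → ψ ∈ H) := by
  constructor
  · intro h h'
    exact hH.mem_of_derives hT (Γ := [.imp φ ψ, φ]) (by simp [h, h'])
      (.impE (φ := φ) (.hyp (by simp)) (.hyp (by simp)))
  · intro h
    by_cases h' : φ ∈ H
    · exact hH.mem_of_derives hT (Γ := [ψ]) (by simpa using h h') (.impI (.hyp (by simp)))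
    · refine hH.mem_of_derives hT (Γ := [φ.neg]) (by simpa using (hH.neg_mem φ).2 h') ?_
      exact .impI (.raa (.impE (φ := φ) (.hyp (by simp [Fm.neg])) (.hyp (by simp))))

theorem allN_mem (hH : IsHenkin T H) (hT : SubstClosed T) (φ : Fm) :
    Fm.allN φ ∈ H ↔ ∀ t, φ.instN t ∈ H := by
  refine ⟨fun h t => hH.mem_of_derives hT (Γ := [.allN φ]) (by simpa using h)
    (.allNE t (.hyp (by simp))), fun h => (hH.allN φ).resolve_right ?_⟩
  rintro ⟨t, ht⟩
  exact (hH.neg_mem _).1 ht (h t)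

theorem allS_mem (hH : IsHenkin T H) (hT : SubstClosed T) (φ : Fm) :
    Fm.allS φ ∈ H ↔ ∀ X, φ.instS X ∈ H := by
  refine ⟨fun h t => hH.mem_of_derives hT (Γ := [.allS φ]) (by simpa using h)
    (.allSE t (.hyp (by simp))), fun h => (hH.allS φ).resolve_right ?_⟩
  rintro ⟨t, ht⟩
  exact (hH.neg_mem _).1 ht (h t)

theorem eq_refl (hH : IsHenkin T H) (hT : SubstClosed T) (t : Tm) : Fm.eq t t ∈ H :=
  hH.mem_of_derives hT (Γ := []) (by simp) (.eqRefl t)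

theorem eq_subst (hH : IsHenkin T H) (hT : SubstClosed T) (φ : Fm) {t s : Tm}
    (h : Fm.eq t s ∈ H) (h' : φ.instN t ∈ H) : φ.instN s ∈ H :=
  hH.mem_of_derives hT (Γ := [.eq t s, φ.instN t]) (by simp [h, h'])
    (.eqSubst φ (t := t) (.hyp (by simp)) (.hyp (by simp)))

theorem eq_symm (hH : IsHenkin T H) (hT : SubstClosed T) {t s : Tm} (h : Fm.eq t s ∈ H) :
    Fm.eq s t ∈ H := by
  have := hH.eq_subst hT (.eq (.var 0) (t.up 1)) h
  simp only [Fm.instN, Fm.subst, Tm.up_one_subst, implies_true] at this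
  exact this (hH.eq_refl hT t)

theorem eq_trans (hH : IsHenkin T H) (hT : SubstClosed T) {t s r : Tm} (h : Fm.eq t s ∈ H)
    (h' : Fm.eq s r ∈ H) : Fm.eq t r ∈ H := by
  have := hH.eq_subst hT (.eq (t.up 1) (.var 0)) h'
  simp only [Fm.instN, Fm.subst, Tm.up_one_subst, implies_true] at this
  exact this h

/-- Equality of terms according to the Henkin set. -/
def setoid (hH : IsHenkin T H) (hT : SubstClosed T) : Setoid Tm where
  r t s := Fm.eq t s ∈ H
  iseqv := ⟨hH.eq_refl hT, hH.eq_symm hT, hH.eq_trans hT⟩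

theorem eq_congr₂ (hH : IsHenkin T H) (hT : SubstClosed T) (f : Tm → Tm → Tm)
    (hf : ∀ t s σ, (f t s).subst σ = f (t.subst σ) (s.subst σ)) {t t' s s' : Tm}
    (ht : Fm.eq t t' ∈ H) (hs : Fm.eq s s' ∈ H) : Fm.eq (f t s) (f t' s') ∈ H := by
  have h₁ := hH.eq_subst hT (.eq ((f t s).up 1) (f (.var 0) (s.up 1))) ht
  have h₂ := hH.eq_subst hT (.eq ((f t s).up 1) (f (t'.up 1) (.var 0))) hs
  simp only [Fm.instN, Fm.subst, hf, Tm.up_one_subst, implies_true] at h₁ h₂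
  exact h₂ (h₁ (hH.eq_refl hT _))

theorem lt_congr (hH : IsHenkin T H) (hT : SubstClosed T) {t t' s s' : Tm}
    (ht : Fm.eq t t' ∈ H) (hs : Fm.eq s s' ∈ H) (h : Fm.lt t s ∈ H) : Fm.lt t' s' ∈ H := by
  have h₁ := hH.eq_subst hT (.lt (.var 0) (s.up 1)) ht
  have h₂ := hH.eq_subst hT (.lt (t'.up 1) (.var 0)) hs
  simp only [Fm.instN, Fm.subst, Tm.up_one_subst, implies_true] at h₁ h₂
  exact h₂ (h₁ h)

theorem mem_congr (hH : IsHenkin T H) (hT : SubstClosed T) {t t' : Tm} (X : ℕ)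
    (ht : Fm.eq t t' ∈ H) (h : Fm.mem t X ∈ H) : Fm.mem t' X ∈ H :=
  hH.eq_subst hT (.mem (.var 0) X) ht h

/-- The term model of a Henkin set. -/
def interp (hH : IsHenkin T H) (hT : SubstClosed T) : Interp where
  M := Quotient (hH.setoid hT)
  zero := ⟦.zero⟧
  one := ⟦.one⟧
  add := Quotient.map₂ .add fun _ _ h _ _ h' => hH.eq_congr₂ hT .add (fun _ _ _ => rfl) h h'
  mul := Quotient.map₂ .mul fun _ _ h _ _ h' => hH.eq_congr₂ hT .mul (fun _ _ _ => rfl) h h'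
  lt := Quotient.lift₂ (fun t s => Fm.lt t s ∈ H) fun _ _ _ _ h h' =>
    propext ⟨hH.lt_congr hT h h', hH.lt_congr hT (hH.eq_symm hT h) (hH.eq_symm hT h')⟩
  E X := {a | Quotient.lift (fun t => Fm.mem t X ∈ H) (fun _ _ h =>
    propext ⟨hH.mem_congr hT X h, hH.mem_congr hT X (hH.eq_symm hT h)⟩) a}

/-- The class of a term, as an element of the term model. -/
def cls (hH : IsHenkin T H) (hT : SubstClosed T) (t : Tm) : (hH.interp hT).M :=
  Quotient.mk (hH.setoid hT) t

theorem val_interp (hH : IsHenkin T H) (hT : SubstClosed T) (t : Tm) :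
    t.val (hH.interp hT) (fun i => hH.cls hT (.var i)) = hH.cls hT t := by
  induction t with
  | add t s iht ihs => rw [Tm.val, iht, ihs]; rfl
  | mul t s iht ihs => rw [Tm.val, iht, ihs]; rfl
  | _ => rfl

/-- The number of connectives and quantifiers of a formula; unlike the structural order, it is
compatible with substitution. -/
def size : Fm → ℕ
  | .imp φ ψ => size φ + size ψ + 1
  | .allN φ => size φ + 1
  | .allS φ => size φ + 1
  | _ => 0

theorem size_subst (φ : Fm) : ∀ σ ρ, size (φ.subst σ ρ) = size φ := by
  induction φ <;> simp_all [Fm.subst, size]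

/-- The truth lemma: the term model satisfies exactly the members of the Henkin set, when each
variable denotes its own class. -/
theorem sat_interp (hH : IsHenkin T H) (hT : SubstClosed T) (n : ℕ) : ∀ φ, size φ ≤ n →
    (φ.Sat (hH.interp hT) (fun i => hH.cls hT (.var i)) id ↔ φ ∈ H) := by
  induction n using Nat.strong_induction_on with
  | _ n ih =>
  intro φ hφ
  cases φ with
  | eq t s =>
    rw [Fm.Sat, val_interp, val_interp]
    exact Quotient.eq (r := hH.setoid hT)
  | lt t s =>
    rw [Fm.Sat, val_interp, val_interp]
    rfl
  | mem t X =>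
    rw [Fm.Sat, val_interp]
    rfl
  | bot => exact iff_of_false id hH.bot_not_mem
  | imp φ ψ =>
    simp only [size] at hφ
    rw [Fm.Sat, hH.imp_mem hT, ih (size φ) (by omega) φ le_rfl, ih (size ψ) (by omega) ψ le_rfl]
  | allN φ =>
    simp only [size] at hφ
    have key : ∀ t, φ.Sat (hH.interp hT) (push (hH.cls hT t) fun i => hH.cls hT (.var i)) id ↔
        φ.instN t ∈ H := by
      intro t
      rw [← ih (size φ) (by omega) (φ.instN t) (size_subst φ _ _).le, Fm.sat_instN, val_interp]
    rw [Fm.Sat, hH.allN_mem hT]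
    refine ⟨fun h t => (key t).1 (h _), fun h a => ?_⟩
    induction a using Quotient.inductionOn with
    | _ t => exact (key t).2 (h t)
  | allS φ =>
    simp only [size] at hφ
    rw [Fm.Sat, hH.allS_mem hT]
    refine forall_congr' fun X => ?_
    rw [← ih (size φ) (by omega) (φ.instS X) (size_subst φ _ _).le, Fm.sat_instS]
    rfl

end IsHenkin

end Completeness

/-- The interpretation `A` satisfies all axioms of `T`, with free variables read universally. -/
def Interp.Models (A : Interp) (T : Set Fm) : Prop := ∀ φ ∈ T, ∀ v ρ, φ.Sat A v ρ

/-- **Completeness**: a formula valid in all countable models of `T` is provable from `T`. -/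
theorem proves_of_models {T : Set Fm} (hT : SubstClosed T) (φ : Fm)
    (h : ∀ A : Interp, Countable A.M → A.Models T → ∀ v ρ, φ.Sat A v ρ) : Proves T φ := by
  refine .raa (by_contra fun hcons => ?_)
  obtain ⟨H, hH, hφ⟩ := exists_isHenkin hT _ hcons
  refine (hH.neg_mem φ).1 (hφ _ (by simp)) ((hH.sat_interp hT _ φ le_rfl).1 (h _ ?_ ?_ _ _))
  · exact inferInstanceAs (Countable (Quotient (hH.setoid hT)))
  · intro χ hχ v ρ
    -- Every assignment in the term model comes from a substitution, and `T` is closed under it.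
    have hv : ∀ i, ∃ t, hH.cls hT t = v i := fun i => Quotient.exists_rep (v i)
    choose σ hσ using hv
    have h₁ : χ.subst σ ρ ∈ H := hH.mem_of_derives hT (Γ := []) (by simp) (.ax (hT χ hχ σ ρ))
    rw [← hH.sat_interp hT _ _ le_rfl, Fm.sat_subst] at h₁
    simpa only [IsHenkin.val_interp, hσ, id] using h₁

/-! ### Models of `WKL₀` -/

theorem IsBounded.subst {φ : Fm} (h : IsBounded φ) : ∀ σ ρ, IsBounded (φ.subst σ ρ) := by
  induction h with
  | eq t s => exact fun σ ρ => .eq _ _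
  | lt t s => exact fun σ ρ => .lt _ _
  | mem t X => exact fun σ ρ => .mem _ _
  | bot => exact fun σ ρ => .bot
  | imp _ _ ih₁ ih₂ => exact fun σ ρ => .imp (ih₁ σ ρ) (ih₂ σ ρ)
  | ballN t _ ih =>
    intro σ ρ
    have := IsBounded.ballN (t.subst σ) (ih (liftN σ) ρ)
    rwa [← Tm.up_subst_liftN] at this
  | bexN t _ ih =>
    intro σ ρ
    have := IsBounded.bexN (t.subst σ) (ih (liftN σ) ρ)
    rwa [← Tm.up_subst_liftN] at this

theorem inductionAxiom_subst (φ : Fm) (σ : ℕ → Tm) (ρ : ℕ → ℕ) :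
    (inductionAxiom φ).subst σ ρ = inductionAxiom (φ.subst (liftN σ) ρ) := by
  simp only [inductionAxiom, Fm.and, Fm.neg, Fm.subst, Fm.instN_subst, Fm.succ_subst, Tm.subst]

theorem comprehensionAxiom_subst (φ ψ : Fm) (σ : ℕ → Tm) (ρ : ℕ → ℕ) :
    (comprehensionAxiom φ ψ).subst σ ρ =
      comprehensionAxiom (φ.subst (liftN σ) ρ) (ψ.subst (liftN σ) ρ) := by
  simp only [comprehensionAxiom, Fm.iff, Fm.exS, Fm.and, Fm.neg, Fm.subst, Fm.shiftS_subst,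
    Tm.subst, liftN, liftS]

theorem substClosed_WKL0 : SubstClosed WKL0 := by
  rintro φ (((hφ | ⟨φ, ⟨θ, hθ, rfl⟩, rfl⟩) | ⟨φ, ψ, ⟨θ, hθ, rfl⟩, ⟨θ', hθ', rfl⟩, rfl⟩) | rfl) σ ρ
  · have : φ.subst σ ρ = φ := by
      rcases hφ with rfl | rfl | rfl | rfl | rfl | rfl | rfl | rfl <;> rfl
    rw [this]
    exact .inl (.inl (.inl hφ))
  · rw [inductionAxiom_subst]
    exact .inl (.inl (.inr ⟨_, ⟨_, hθ.subst (liftN (liftN σ)) ρ, rfl⟩, rfl⟩))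
  · rw [comprehensionAxiom_subst]
    exact .inl (.inr ⟨_, _, ⟨_, hθ.subst (liftN (liftN σ)) ρ, rfl⟩,
      ⟨_, hθ'.subst (liftN (liftN σ)) ρ, rfl⟩, rfl⟩)
  · exact .inr rfl

section Sat

variable (A : Interp) (v : ℕ → A.M) (ρ : ℕ → ℕ) (φ ψ : Fm)

theorem Fm.sat_neg : φ.neg.Sat A v ρ ↔ ¬φ.Sat A v ρ := Iff.rfl

theorem Fm.sat_imp : (φ.imp ψ).Sat A v ρ ↔ (φ.Sat A v ρ → ψ.Sat A v ρ) := Iff.rfl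

theorem Fm.sat_and : (φ.and ψ).Sat A v ρ ↔ φ.Sat A v ρ ∧ ψ.Sat A v ρ := by
  simp [Fm.and, Fm.neg, Fm.Sat]

theorem Fm.sat_or : (φ.or ψ).Sat A v ρ ↔ φ.Sat A v ρ ∨ ψ.Sat A v ρ := by
  simp [Fm.or, Fm.neg, Fm.Sat, or_iff_not_imp_left]

theorem Fm.sat_iff : (φ.iff ψ).Sat A v ρ ↔ (φ.Sat A v ρ ↔ ψ.Sat A v ρ) := by
  simp [Fm.iff, Fm.sat_and, Fm.Sat, iff_def]

theorem Fm.sat_allN : (Fm.allN φ).Sat A v ρ ↔ ∀ a, φ.Sat A (push a v) ρ := Iff.rfl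

theorem Fm.sat_allS : (Fm.allS φ).Sat A v ρ ↔ ∀ X, φ.Sat A v (push X ρ) := Iff.rfl

theorem Fm.sat_exN : (Fm.exN φ).Sat A v ρ ↔ ∃ a, φ.Sat A (push a v) ρ := by
  simp [Fm.exN, Fm.neg, Fm.Sat]

theorem Fm.sat_exS : (Fm.exS φ).Sat A v ρ ↔ ∃ X, φ.Sat A v (push X ρ) := by
  simp [Fm.exS, Fm.neg, Fm.Sat]

end Sat

/-- Countable models of `WKL₀`. -/
class IsModel (A : Interp) : Prop where
  models : A.Models WKL0
  countable : Countable A.M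

section Instances

variable {A : Interp}

instance : Zero A.M := ⟨A.zero⟩
instance : One A.M := ⟨A.one⟩
instance : Add A.M := ⟨A.add⟩
instance : Mul A.M := ⟨A.mul⟩
instance : LT A.M := ⟨A.lt⟩
instance : LE A.M := ⟨fun a b => a < b ∨ a = b⟩

end Instances

/-! ### Predicates defined by bounded formulas

Predicates of several numbers are written as predicates on the products `A.M`, `A.M × A.M`,
`(A.M × A.M) × A.M`, and so on; every element of `A.M` and every set of `A` is available as a
parameter. -/

section Definability

theorem exists_enum (A : Interp) [IsModel A] : ∃ u : ℕ → A.M, Function.Surjective u :=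
  have := IsModel.countable (A := A)
  have : Nonempty A.M := ⟨0⟩
  exists_surjective_nat A.M

/-- A type of tuples of elements of `A.M`, each tuple being read as an assignment to the number
variables. The variables that the tuple leaves free enumerate `A.M`, so that all parameters are
values of variables. -/
class Ctx (A : outParam Interp) (α : Type) where
  env : α → ℕ → A.M
  exists_env_eq : ∀ a, ∃ i, ∀ c, env c i = a

variable {A : Interp}

noncomputable instance [IsModel A] : Ctx A A.M where
  env a := push a (exists_enum A).choose
  exists_env_eq a := by
    obtain ⟨i, hi⟩ := (exists_enum A).choose_spec a
    exact ⟨i + 1, fun _ => hi⟩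

instance {α : Type} [Ctx A α] : Ctx A (α × A.M) where
  env c := push c.2 (Ctx.env c.1)
  exists_env_eq a := by
    obtain ⟨i, hi⟩ := Ctx.exists_env_eq (α := α) a
    exact ⟨i + 1, fun c => hi c.1⟩

variable {α β : Type} [Ctx A α] [Ctx A β]

/-- `f` drops some of the last components of a tuple. -/
def Proj (f : α → β) : Prop := ∃ k, ∀ c i, Ctx.env (f c) i = Ctx.env c (i + k)

theorem Proj.id : Proj fun c : α => c := ⟨0, fun _ _ => rfl⟩

theorem Proj.fst {f : α → β × A.M} (hf : Proj f) : Proj fun c => (f c).1 := by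
  obtain ⟨k, hk⟩ := hf
  refine ⟨k + 1, fun c i => (hk c (i + 1)).trans (congrArg _ (by omega))⟩

/-- `f` is the value of a term with parameters. -/
def TermFun (f : α → A.M) : Prop := ∃ t : Tm, ∀ c, f c = t.val A (Ctx.env c)

theorem TermFun.zero : TermFun fun _ : α => (0 : A.M) := ⟨.zero, fun _ => rfl⟩

theorem TermFun.one : TermFun fun _ : α => (1 : A.M) := ⟨.one, fun _ => rfl⟩

theorem TermFun.add {f g : α → A.M} (hf : TermFun f) (hg : TermFun g) :
    TermFun fun c => f c + g c := by
  obtain ⟨t, ht⟩ := hf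
  obtain ⟨s, hs⟩ := hg
  exact ⟨.add t s, fun c => congrArg₂ A.add (ht c) (hs c)⟩

theorem TermFun.mul {f g : α → A.M} (hf : TermFun f) (hg : TermFun g) :
    TermFun fun c => f c * g c := by
  obtain ⟨t, ht⟩ := hf
  obtain ⟨s, hs⟩ := hg
  exact ⟨.mul t s, fun c => congrArg₂ A.mul (ht c) (hs c)⟩

theorem TermFun.snd {f : α → β × A.M} (hf : Proj f) : TermFun fun c => (f c).2 := by
  obtain ⟨k, hk⟩ := hf
  exact ⟨.var (0 + k), fun c => hk c 0⟩

theorem TermFun.proj [IsModel A] {f : α → A.M} (hf : Proj f) : TermFun f := by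
  obtain ⟨k, hk⟩ := hf
  exact ⟨.var (0 + k), fun c => hk c 0⟩

theorem TermFun.const (a : A.M) : TermFun fun _ : α => a := by
  obtain ⟨i, hi⟩ := Ctx.exists_env_eq (α := α) a
  exact ⟨.var i, fun c => (hi c).symm⟩

/-- `R` is defined by a bounded formula with number and set parameters. -/
def Delta0 (R : α → Prop) : Prop :=
  ∃ φ, IsBounded φ ∧ ∀ c, R c ↔ φ.Sat A (Ctx.env c) id

namespace Delta0

theorem of_iff {R Q : α → Prop} (hQ : Delta0 Q) (h : ∀ c, R c ↔ Q c) : Delta0 R := by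
  rwa [funext fun c => propext (h c)]

theorem eq {f g : α → A.M} (hf : TermFun f) (hg : TermFun g) : Delta0 fun c => f c = g c := by
  obtain ⟨t, ht⟩ := hf
  obtain ⟨s, hs⟩ := hg
  exact ⟨.eq t s, .eq t s, fun c => iff_of_eq (congrArg₂ Eq (ht c) (hs c))⟩

theorem lt {f g : α → A.M} (hf : TermFun f) (hg : TermFun g) : Delta0 fun c => f c < g c := by
  obtain ⟨t, ht⟩ := hf
  obtain ⟨s, hs⟩ := hg
  exact ⟨.lt t s, .lt t s, fun c => iff_of_eq (congrArg₂ A.lt (ht c) (hs c))⟩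

theorem mem {f : α → A.M} (hf : TermFun f) (X : ℕ) : Delta0 fun c => f c ∈ A.E X := by
  obtain ⟨t, ht⟩ := hf
  exact ⟨.mem t X, .mem t X, fun c => iff_of_eq (congrArg (· ∈ A.E X) (ht c))⟩

theorem false : Delta0 fun _ : α => False := ⟨.bot, .bot, fun _ => Iff.rfl⟩

theorem imp {R Q : α → Prop} (hR : Delta0 R) (hQ : Delta0 Q) : Delta0 fun c => R c → Q c := by
  obtain ⟨φ, hφ, hR⟩ := hR
  obtain ⟨ψ, hψ, hQ⟩ := hQ
  exact ⟨.imp φ ψ, .imp hφ hψ, fun c => imp_congr (hR c) (hQ c)⟩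

theorem not {R : α → Prop} (hR : Delta0 R) : Delta0 fun c => ¬R c := hR.imp .false

theorem notMem {f : α → A.M} (hf : TermFun f) (X : ℕ) : Delta0 fun c => f c ∉ A.E X :=
  (mem hf X).not

theorem and {R Q : α → Prop} (hR : Delta0 R) (hQ : Delta0 Q) : Delta0 fun c => R c ∧ Q c :=
  (hR.imp hQ.not).not.of_iff fun c => by simp

theorem or {R Q : α → Prop} (hR : Delta0 R) (hQ : Delta0 Q) : Delta0 fun c => R c ∨ Q c :=
  (hR.not.imp hQ).of_iff fun _ => or_iff_not_imp_left

theorem le {f g : α → A.M} (hf : TermFun f) (hg : TermFun g) : Delta0 fun c => f c ≤ g c :=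
  (lt hf hg).or (eq hf hg)

theorem iff {R Q : α → Prop} (hR : Delta0 R) (hQ : Delta0 Q) : Delta0 fun c => R c ↔ Q c :=
  ((hR.imp hQ).and (hQ.imp hR)).of_iff fun _ => iff_def

theorem ball {f : α → A.M} {R : α → A.M → Prop} (hf : TermFun f)
    (hR : Delta0 fun p : α × A.M => R p.1 p.2) : Delta0 fun c => ∀ x, x < f c → R c x := by
  obtain ⟨t, ht⟩ := hf
  obtain ⟨φ, hφ, hR⟩ := hR
  refine ⟨_, .ballN t hφ, fun c => forall_congr' fun x => imp_congr ?_ (hR (c, x))⟩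
  rw [ht c, ← t.val_up_one A _ x]
  rfl

theorem bex {f : α → A.M} {R : α → A.M → Prop} (hf : TermFun f)
    (hR : Delta0 fun p : α × A.M => R p.1 p.2) : Delta0 fun c => ∃ x, x < f c ∧ R c x :=
  (ball (R := fun c x => ¬R c x) hf hR.not).not.of_iff fun c => by simp

end Delta0

/-- The pairing function of `pair`. -/
def prs (i j : A.M) : A.M := (i + j) * (i + j) + i

theorem TermFun.prs {f g : α → A.M} (hf : TermFun f) (hg : TermFun g) :
    TermFun fun c => prs (f c) (g c) :=
  ((hf.add hg).mul (hf.add hg)).add hf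

/-- Substitution of term functions into a bounded predicate. -/
theorem Delta0.comp {R : β → Prop} (hR : Delta0 R) (h : α → β)
    (hh : ∀ i, TermFun fun c => Ctx.env (h c) i) : Delta0 fun c => R (h c) := by
  obtain ⟨φ, hφ, hR⟩ := hR
  choose σ hσ using hh
  refine ⟨_, hφ.subst σ id, fun c => (hR (h c)).trans ?_⟩
  rw [Fm.sat_subst]
  exact iff_of_eq (congrArg (fun w => φ.Sat A w _) (funext fun i => hσ i c))

theorem Delta0.comp₂ [IsModel A] {R : A.M → A.M → Prop} (hR : Delta0 fun p : A.M × A.M => R p.1 p.2)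
    {f g : α → A.M} (hf : TermFun f) (hg : TermFun g) : Delta0 fun c => R (f c) (g c) :=
  hR.comp (fun c => (f c, g c)) fun i => match i with
    | 0 => hg
    | 1 => hf
    | _ + 2 => .const _

theorem Delta0.comp₁ [IsModel A] {R : A.M → Prop} (hR : Delta0 R) {f : α → A.M}
    (hf : TermFun f) : Delta0 fun c => R (f c) :=
  hR.comp f fun i => match i with
    | 0 => hf
    | _ + 1 => .const _

/-- `i` is an element of the finite set represented by `s`, with explicit bounds on all
quantifiers. -/
def FinMem (i s : A.M) : Prop :=
  ∃ k, k < s + 1 ∧ ∃ m, m < s + 1 ∧ ∃ n, n < s + 1 ∧ s = prs k (prs m n) ∧ i < k ∧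
    ∃ q, q < n + 1 ∧ n = (m * (i + 1) + 1) * q

theorem Delta0.finMem [IsModel A] {f g : α → A.M} (hf : TermFun f) (hg : TermFun g) :
    Delta0 fun c => FinMem (f c) (g c) := by
  refine Delta0.comp₂ ?_ hf hg
  exact .bex (.add (.snd .id) .one) <| .bex (.add (.snd (.fst .id)) .one) <|
    .bex (.add (.snd (.fst (.fst .id))) .one) <| .and
      (.eq (.snd (.fst (.fst (.fst .id))))
        (.prs (.snd (.fst (.fst .id))) (.prs (.snd (.fst .id)) (.snd .id)))) <|
      .and (.lt (.proj (.fst (.fst (.fst (.fst .id))))) (.snd (.fst (.fst .id)))) <|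
      .bex (.add (.snd .id) .one) <| .eq (.snd (.fst .id)) <|
        .mul (.add (.mul (.snd (.fst (.fst .id)))
          (.add (.proj (.fst (.fst (.fst (.fst (.fst .id)))))) .one)) .one) (.snd .id)

/-- Proves that a predicate is bounded by recursion on its form. -/
theorem Delta0.auto [IsModel A] {R : α → Prop} (h : Delta0 R := by
    with_reducible_and_instances repeat' first
      | apply Delta0.false | apply Delta0.eq | apply Delta0.lt | apply Delta0.le
      | apply Delta0.mem | apply Delta0.notMem | apply Delta0.finMem | apply Delta0.not
      | apply Delta0.and | apply Delta0.or | apply Delta0.iff | apply Delta0.bex | apply Delta0.ball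
      | apply Delta0.imp | apply TermFun.zero | apply TermFun.one | apply TermFun.const
      | apply TermFun.add | apply TermFun.mul | apply TermFun.prs | apply TermFun.snd
      | apply TermFun.proj | apply Proj.id | apply Proj.fst) : Delta0 R :=
  h

end Definability

section Axioms

variable {A : Interp} [IsModel A]

theorem sat_of_mem_basicAxioms {φ : Fm} (h : φ ∈ basicAxioms) (v ρ) : φ.Sat A v ρ :=
  IsModel.models φ (.inl (.inl (.inl h))) v ρ

namespace Arith

theorem succ_ne_zero (a : A.M) : a + 1 ≠ 0 :=
  sat_of_mem_basicAxioms (.inl rfl) (fun _ => 0) id a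

theorem succ_inj {a b : A.M} (h : a + 1 = b + 1) : a = b :=
  sat_of_mem_basicAxioms (.inr (.inl rfl)) (fun _ => 0) id a b h

theorem add_zero (a : A.M) : a + 0 = a :=
  sat_of_mem_basicAxioms (.inr (.inr (.inl rfl))) (fun _ => 0) id a

theorem add_succ (a b : A.M) : a + (b + 1) = a + b + 1 :=
  sat_of_mem_basicAxioms (.inr (.inr (.inr (.inl rfl)))) (fun _ => 0) id a b

theorem mul_zero (a : A.M) : a * 0 = 0 :=
  sat_of_mem_basicAxioms (.inr (.inr (.inr (.inr (.inl rfl))))) (fun _ => 0) id a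

theorem mul_succ (a b : A.M) : a * (b + 1) = a * b + a :=
  sat_of_mem_basicAxioms (.inr (.inr (.inr (.inr (.inr (.inl rfl)))))) (fun _ => 0) id a b

theorem not_lt_zero (a : A.M) : ¬a < 0 :=
  sat_of_mem_basicAxioms (.inr (.inr (.inr (.inr (.inr (.inr (.inl rfl))))))) (fun _ => 0) id a

theorem lt_succ_iff {a b : A.M} : a < b + 1 ↔ a < b ∨ a = b := by
  have := sat_of_mem_basicAxioms (A := A)
    (.inr (.inr (.inr (.inr (.inr (.inr (.inr rfl))))))) (fun _ => 0) id a b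
  rwa [Fm.sat_iff, Fm.sat_or] at this

end Arith

/-- `Σ⁰₁` induction. -/
theorem sigma_induction (R : A.M → A.M → Prop) (x : A.M)
    (zero : ∃ y, R 0 y) (succ : ∀ x, (∃ y, R x y) → ∃ y, R (x + 1) y)
    (hR : Delta0 fun p : A.M × A.M => R p.1 p.2 := by exact .auto) : ∃ y, R x y := by
  obtain ⟨φ, hφ, hR⟩ := hR
  have h := IsModel.models (A := A) _ (.inl (.inl (.inr ⟨_, ⟨φ, hφ, rfl⟩, rfl⟩)))
    (exists_enum A).choose id
  have key : ∀ x, (Fm.exN φ).Sat A (push x (exists_enum A).choose) id ↔ ∃ y, R x y := by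
    intro x
    rw [Fm.sat_exN]
    exact exists_congr fun y => (hR (x, y)).symm
  simp only [inductionAxiom, Fm.sat_imp, Fm.sat_and, Fm.sat_allN, Fm.sat_instN, Fm.sat_succ,
    key] at h
  exact h ⟨zero, succ⟩ x

/-- Induction for bounded formulas. -/
theorem induction (R : A.M → Prop) (x : A.M) (zero : R 0) (succ : ∀ x, R x → R (x + 1))
    (hR : Delta0 fun x => R x := by exact .auto) : R x :=
  (sigma_induction (fun x _ => R x) x ⟨0, zero⟩ (fun x ⟨_, h⟩ => ⟨0, succ x h⟩)
    (.comp₁ hR (.proj (.fst .id)))).elim fun _ => id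

/-- `Δ⁰₁` comprehension. -/
theorem delta_comprehension {R : A.M → Prop} {Q Q' : A.M → A.M → Prop}
    (h : ∀ x, R x ↔ ∃ y, Q x y) (h' : ∀ x, R x ↔ ∀ y, Q' x y)
    (hQ : Delta0 fun p : A.M × A.M => Q p.1 p.2 := by exact .auto)
    (hQ' : Delta0 fun p : A.M × A.M => Q' p.1 p.2 := by exact .auto) :
    ∃ X, ∀ x, x ∈ A.E X ↔ R x := by
  obtain ⟨φ, hφ, hQ⟩ := hQ
  obtain ⟨ψ, hψ, hQ'⟩ := hQ'
  have key : ∀ x, (Fm.exN φ).Sat A (push x (exists_enum A).choose) id ↔ R x := by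
    intro x
    rw [Fm.sat_exN, h]
    exact exists_congr fun y => (hQ (x, y)).symm
  have key' : ∀ x, (Fm.allN ψ).Sat A (push x (exists_enum A).choose) id ↔ R x := by
    intro x
    rw [Fm.sat_allN, h']
    exact forall_congr' fun y => (hQ' (x, y)).symm
  have hc := IsModel.models (A := A) _
    (.inl (.inr ⟨_, _, ⟨φ, hφ, rfl⟩, ⟨ψ, hψ, rfl⟩, rfl⟩)) (exists_enum A).choose id
  rw [comprehensionAxiom, Fm.sat_imp, Fm.sat_allN, Fm.sat_exS] at hc
  obtain ⟨X, hX⟩ := hc fun x => by rw [Fm.sat_iff, key, key']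
  refine ⟨X, fun x => ?_⟩
  have := (Fm.sat_allN A _ _ _).1 hX x
  rw [Fm.sat_iff, Fm.sat_shiftS, key] at this
  exact this

/-- Comprehension for bounded formulas. -/
theorem comprehension (R : A.M → Prop) (hR : Delta0 fun x => R x := by exact .auto) :
    ∃ X, ∀ x, x ∈ A.E X ↔ R x :=
  have hR' := Delta0.comp₁ hR (TermFun.proj (.fst (.id (α := A.M × A.M))))
  delta_comprehension (Q := fun x _ => R x) (Q' := fun x _ => R x)
    (fun _ => ⟨fun h => ⟨0, h⟩, fun ⟨_, h⟩ => h⟩) (fun _ => ⟨fun h _ => h, fun h => h 0⟩) hR' hR'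

end Axioms

/-! ### Arithmetic in a model -/

section Semiring

variable {A : Interp} [IsModel A]

namespace Arith

theorem zero_add (a : A.M) : 0 + a = a :=
  induction (fun a => 0 + a = a) a (add_zero 0) fun a h => by rw [add_succ, h]

theorem succ_add (a b : A.M) : a + 1 + b = a + b + 1 :=
  induction (fun b => a + 1 + b = a + b + 1) b (by rw [add_zero, add_zero])
    fun b h => by rw [add_succ, add_succ, h]

theorem add_comm (a b : A.M) : a + b = b + a :=
  induction (fun b => a + b = b + a) b (by rw [add_zero, zero_add])
    fun b h => by rw [add_succ, succ_add, h]

theorem add_assoc (a b c : A.M) : a + b + c = a + (b + c) :=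
  induction (fun c => a + b + c = a + (b + c)) c (by rw [add_zero, add_zero])
    fun c h => by rw [add_succ, add_succ, add_succ, h]

theorem zero_mul (a : A.M) : 0 * a = 0 :=
  induction (fun a => 0 * a = 0) a (mul_zero 0) fun a h => by rw [mul_succ, h, add_zero]

theorem succ_mul (a b : A.M) : (a + 1) * b = a * b + b :=
  induction (fun b => (a + 1) * b = a * b + b) b (by rw [mul_zero, mul_zero, add_zero])
    fun b h => by rw [mul_succ, mul_succ, h, ← add_assoc, ← add_assoc, add_assoc _ b a,
      add_comm b a, ← add_assoc]

theorem mul_comm (a b : A.M) : a * b = b * a :=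
  induction (fun b => a * b = b * a) b (by rw [mul_zero, zero_mul])
    fun b h => by rw [mul_succ, succ_mul, h]

theorem mul_add (a b c : A.M) : a * (b + c) = a * b + a * c :=
  induction (fun c => a * (b + c) = a * b + a * c) c (by rw [mul_zero, add_zero, add_zero])
    fun c h => by rw [add_succ, mul_succ, mul_succ, h, add_assoc]

theorem mul_assoc (a b c : A.M) : a * b * c = a * (b * c) :=
  induction (fun c => a * b * c = a * (b * c)) c (by rw [mul_zero, mul_zero, mul_zero])
    fun c h => by rw [mul_succ, mul_succ, mul_add, h]

theorem mul_one (a : A.M) : a * 1 = a := by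
  rw [← zero_add 1, mul_succ, mul_zero, zero_add]

theorem add_right_cancel {a b : A.M} (c : A.M) : a + c = b + c → a = b :=
  induction (fun c => a + c = b + c → a = b) c (by rw [add_zero, add_zero]; exact id)
    fun c h h' => h (succ_inj (by rwa [← add_succ, ← add_succ]))

theorem lt_add_succ (a c : A.M) : a < a + (c + 1) :=
  induction (fun c => a < a + (c + 1)) c (by rw [zero_add]; exact lt_succ_iff.2 (.inr rfl))
    fun c h => by rw [add_succ]; exact lt_succ_iff.2 (.inl h)

theorem lt_iff {a b : A.M} : a < b ↔ ∃ c, a + (c + 1) = b := by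
  refine ⟨fun h => ?_, fun ⟨c, h⟩ => h ▸ lt_add_succ a c⟩
  obtain ⟨c, hc⟩ := sigma_induction (fun b c => a < b → a + (c + 1) = b) b
    ⟨0, fun h => (not_lt_zero _ h).elim⟩ fun b ⟨c, hc⟩ => by
      by_cases hab : a < b
      · exact ⟨c + 1, fun _ => by rw [add_succ, hc hab]⟩
      · refine ⟨0, fun h => ?_⟩
        rw [zero_add, (lt_succ_iff.1 h).resolve_left hab]
  exact ⟨c, hc h⟩

theorem lt_irrefl (a : A.M) : ¬a < a := by
  rintro h
  obtain ⟨c, hc⟩ := lt_iff.1 h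
  refine succ_ne_zero c (add_right_cancel a ?_)
  rw [zero_add, add_comm, hc]

theorem lt_trans {a b c : A.M} (h : a < b) (h' : b < c) : a < c := by
  obtain ⟨x, rfl⟩ := lt_iff.1 h
  obtain ⟨y, rfl⟩ := lt_iff.1 h'
  exact lt_iff.2 ⟨x + 1 + y, by rw [add_assoc a, add_succ (x + 1)]⟩

theorem lt_trichotomy (a b : A.M) : a < b ∨ a = b ∨ b < a := by
  refine induction (fun a => a < b ∨ a = b ∨ b < a) a ?_ fun a h => ?_
  · refine induction (fun b => 0 < b ∨ 0 = b ∨ b < 0) b (.inr (.inl rfl)) fun b h => .inl ?_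
    rw [lt_succ_iff]
    exact h.imp_right fun h => h.resolve_right (not_lt_zero b)
  · rcases h with h | rfl | h
    · obtain ⟨c, rfl⟩ := lt_iff.1 h
      rcases em (c = 0) with rfl | hc
      · exact .inr (.inl (by rw [zero_add]))
      · refine .inl (lt_iff.2 ?_)
        obtain ⟨d, rfl⟩ : ∃ d, d + 1 = c := by
          have := sigma_induction (fun c d => c = 0 ∨ d + 1 = c) c ⟨0, .inl rfl⟩
            fun c _ => ⟨c, .inr rfl⟩
          exact this.imp fun d hd => hd.resolve_left hc
        exact ⟨d, by rw [succ_add, ← add_succ a]⟩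
    · exact .inr (.inr (lt_succ_iff.2 (.inr rfl)))
    · exact .inr (.inr (lt_succ_iff.2 (.inl h)))

end Arith

instance : CommSemiring A.M where
  add_assoc := Arith.add_assoc
  zero_add := Arith.zero_add
  add_zero := Arith.add_zero
  add_comm := Arith.add_comm
  mul_assoc := Arith.mul_assoc
  one_mul a := by rw [Arith.mul_comm, Arith.mul_one]
  mul_one := Arith.mul_one
  zero_mul := Arith.zero_mul
  mul_zero := Arith.mul_zero
  left_distrib := Arith.mul_add
  right_distrib a b c := by rw [Arith.mul_comm, Arith.mul_add, Arith.mul_comm c, Arith.mul_comm c]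
  mul_comm := Arith.mul_comm
  nsmul := nsmulRec

open Arith in
noncomputable instance : LinearOrder A.M where
  le_refl _ := .inr rfl
  le_trans a b c := by
    rintro (h | rfl) (h' | rfl)
    exacts [.inl (lt_trans h h'), .inl h, .inl h', .inr rfl]
  le_antisymm a b := by
    rintro (h | rfl) (h' | h')
    exacts [(lt_irrefl a (lt_trans h h')).elim, h'.symm, rfl, rfl]
  le_total a b := by
    rcases lt_trichotomy a b with h | h | h
    exacts [.inl (.inl h), .inl (.inr h), .inr (.inl h)]
  lt_iff_le_not_ge a b := by
    refine ⟨fun h => ⟨.inl h, ?_⟩, fun ⟨h, h'⟩ => h.resolve_right fun h => h' (.inr h.symm)⟩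
    rintro (h' | rfl)
    exacts [lt_irrefl a (lt_trans h h'), lt_irrefl _ h]
  toDecidableLE := Classical.decRel _

theorem lt_iff_exists_add_one {a b : A.M} : a < b ↔ ∃ c, b = a + c + 1 :=
  Arith.lt_iff.trans (exists_congr fun c => by rw [eq_comm, add_assoc])

theorem lt_add_one_iff {a b : A.M} : a < b + 1 ↔ a ≤ b := Arith.lt_succ_iff

theorem le_iff_exists_add' {a b : A.M} : a ≤ b ↔ ∃ c, b = a + c := by
  constructor
  · rintro (h | rfl)
    · obtain ⟨c, rfl⟩ := lt_iff_exists_add_one.1 h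
      exact ⟨c + 1, add_assoc _ _ _⟩
    · exact ⟨0, (add_zero _).symm⟩
  · rintro ⟨c, rfl⟩
    rw [← lt_add_one_iff, lt_iff_exists_add_one]
    exact ⟨c, rfl⟩

instance : IsStrictOrderedRing A.M := by
  have h01 : (0 : A.M) < 1 := lt_iff_exists_add_one.2 ⟨0, by ring⟩
  have hadd : ∀ a b : A.M, a ≤ b → ∀ c, a + c ≤ b + c := fun a b h c => by
    obtain ⟨d, rfl⟩ := le_iff_exists_add'.1 h
    exact le_iff_exists_add'.2 ⟨d, by ring⟩
  have hmul : ∀ a : A.M, 0 < a → ∀ b c, b < c → a * b < a * c := fun a ha b c h => by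
    obtain ⟨d, rfl⟩ := lt_iff_exists_add_one.1 ha
    obtain ⟨e, rfl⟩ := lt_iff_exists_add_one.1 h
    exact lt_iff_exists_add_one.2 ⟨d * e + e + d, by ring⟩
  exact
    { add_le_add_left := hadd
      le_of_add_le_add_left := fun a b c h => by
        obtain ⟨d, hd⟩ := le_iff_exists_add'.1 h
        refine le_iff_exists_add'.2 ⟨d, Arith.add_right_cancel a ?_⟩
        rw [add_comm c, hd]
        ring
      zero_le_one := h01.le
      exists_pair_ne := ⟨0, 1, h01.ne⟩
      mul_lt_mul_of_pos_left := fun a ha b c h => hmul a ha b c h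
      mul_lt_mul_of_pos_right := fun a ha b c h => by
        rw [mul_comm b, mul_comm c]
        exact hmul a ha b c h }

instance : CanonicallyOrderedAdd A.M where
  exists_add_of_le h := le_iff_exists_add'.1 h
  le_add_self _ b := le_iff_exists_add'.2 ⟨b, add_comm _ _⟩
  le_self_add _ b := le_iff_exists_add'.2 ⟨b, rfl⟩

theorem add_one_le_iff {a b : A.M} : a + 1 ≤ b ↔ a < b := by
  rw [← lt_add_one_iff, add_lt_add_iff_right]

theorem eq_zero_or_eq_add_one (a : A.M) : a = 0 ∨ ∃ b, a = b + 1 := by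
  rcases (zero_le (a := a)).eq_or_lt with h | h
  · exact .inl h.symm
  · obtain ⟨b, rfl⟩ := lt_iff_exists_add_one.1 h
    exact .inr ⟨b, by rw [zero_add]⟩

/-- The least number principle for bounded formulas. -/
theorem exists_least (R : A.M → Prop) {a : A.M} (ha : R a)
    (hR : Delta0 fun x => R x := by exact .auto) : ∃ b, R b ∧ ∀ c, c < b → ¬R c := by
  by_contra! h
  have key : ∀ c, c < a + 1 → ¬R c := by
    refine induction (fun x => ∀ c, c < x → ¬R c) (a + 1) (fun c hc => (not_lt_zero hc).elim)
      (fun x ih c hc hR => ?_) (.ball (.proj .id) (.not (.comp₁ hR (.snd .id))))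
    rcases (lt_add_one_iff.1 hc).eq_or_lt with rfl | hc
    · obtain ⟨d, hd, hR⟩ := h c hR
      exact ih d hd hR
    · exact ih c hc hR
  exact key a (lt_add_one_iff.2 le_rfl) ha

end Semiring

/-! ### Codes of finite sets -/

section Coding

variable {A : Interp} [IsModel A]

theorem le_mul_self (a : A.M) : a ≤ a * a := by
  rcases eq_zero_or_eq_add_one a with rfl | ⟨b, rfl⟩
  · exact zero_le
  · exact le_iff_exists_add'.2 ⟨b * (b + 1), by ring⟩

theorem left_le_prs (i j : A.M) : i ≤ prs i j := le_add_self

theorem right_le_prs (i j : A.M) : j ≤ prs i j :=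
  (le_mul_self j).trans ((mul_le_mul' le_add_self le_add_self).trans le_self_add)

theorem prs_le_prs {i i' j j' : A.M} (hi : i ≤ i') (hj : j ≤ j') : prs i j ≤ prs i' j' := by
  unfold prs
  gcongr

theorem prs_ne_of_add_lt {i j i' j' : A.M} (h : i + j < i' + j') : prs i j ≠ prs i' j' := by
  obtain ⟨c, hc⟩ := lt_iff_exists_add_one.1 h
  refine (lt_iff_exists_add_one.2
    ⟨2 * (i + j) * c + c * c + i + 2 * j + 2 * c + i', ?_⟩).ne
  unfold prs
  rw [hc]
  ring

theorem prs_inj {i j i' j' : A.M} : prs i j = prs i' j' ↔ i = i' ∧ j = j' := by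
  refine ⟨fun h => ?_, fun ⟨h, h'⟩ => by rw [h, h']⟩
  have hs : i + j = i' + j' := by
    rcases lt_trichotomy (i + j) (i' + j') with h' | h' | h'
    · exact (prs_ne_of_add_lt h' h).elim
    · exact h'
    · exact (prs_ne_of_add_lt h' h.symm).elim
  unfold prs at h
  rw [hs] at h
  have hi := add_left_cancel h
  subst hi
  exact ⟨rfl, add_left_cancel hs⟩

theorem dvd_iff_bounded {a b : A.M} : a ∣ b ↔ ∃ q, q < b + 1 ∧ b = a * q := by
  refine ⟨fun ⟨q, hq⟩ => ?_, fun ⟨q, _, hq⟩ => ⟨q, hq⟩⟩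
  rcases eq_zero_or_eq_add_one a with rfl | ⟨c, rfl⟩
  · exact ⟨0, lt_add_one_iff.2 zero_le, by rw [hq]; ring⟩
  · exact ⟨q, lt_add_one_iff.2 (le_iff_exists_add'.2 ⟨c * q, by rw [hq]; ring⟩), hq⟩

theorem finMem_prs {i k m n : A.M} :
    FinMem i (prs k (prs m n)) ↔ i < k ∧ m * (i + 1) + 1 ∣ n := by
  constructor
  · rintro ⟨k', -, m', -, n', -, h, hi, hq⟩
    obtain ⟨rfl, h'⟩ := prs_inj.1 h
    obtain ⟨rfl, rfl⟩ := prs_inj.1 h'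
    exact ⟨hi, dvd_iff_bounded.2 hq⟩
  · rintro ⟨hi, hq⟩
    have h := right_le_prs k (prs m n)
    exact ⟨k, lt_add_one_iff.2 (left_le_prs _ _), m, lt_add_one_iff.2 ((left_le_prs _ _).trans h),
      n, lt_add_one_iff.2 ((right_le_prs _ _).trans h), rfl, hi, dvd_iff_bounded.1 hq⟩

theorem FinMem.lt {i s : A.M} (h : FinMem i s) : i < s := by
  obtain ⟨k, -, m, -, n, -, rfl, hi, -⟩ := h
  exact hi.trans_le (left_le_prs _ _)

/-- `s` is of the form of a representation of a finite set. -/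
def IsTriple (s : A.M) : Prop := ∃ k m n, s = prs k (prs m n)

theorem isTriple_iff_bounded {s : A.M} : IsTriple s ↔
    ∃ k, k < s + 1 ∧ ∃ m, m < s + 1 ∧ ∃ n, n < s + 1 ∧ s = prs k (prs m n) := by
  refine ⟨fun ⟨k, m, n, h⟩ => ?_, fun ⟨k, _, m, _, n, _, h⟩ => ⟨k, m, n, h⟩⟩
  have h' := right_le_prs k (prs m n)
  rw [← h] at h'
  exact ⟨k, lt_add_one_iff.2 (h ▸ left_le_prs _ _), m,
    lt_add_one_iff.2 ((left_le_prs _ _).trans h'), n,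
    lt_add_one_iff.2 ((right_le_prs _ _).trans h'), h⟩

/-- `s` is the least representation of a finite set. -/
def IsCode (s : A.M) : Prop :=
  IsTriple s ∧ ∀ s', s' < s ∧ IsTriple s' → ¬∀ i, FinMem i s' ↔ FinMem i s

theorem exists_forall_dvd (k : A.M) : ∃ m : A.M, 0 < m ∧ ∀ d, d < k → 0 < d → d ∣ m := by
  simp only [dvd_iff_bounded]
  refine sigma_induction (fun k m => 0 < m ∧ ∀ d, d < k → 0 < d → ∃ q, q < m + 1 ∧ m = d * q) k
    ⟨1, zero_lt_one, fun d hd => (not_lt_zero hd).elim⟩ fun k ⟨m, hm, h⟩ => ?_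
  simp only [← dvd_iff_bounded] at h ⊢
  rcases (zero_le (a := k)).eq_or_lt with rfl | hk
  · refine ⟨m, hm, fun d hd hd' => ?_⟩
    exact (hd'.not_ge (lt_add_one_iff.1 hd)).elim
  · refine ⟨m * k, mul_pos hm hk, fun d hd hd' => ?_⟩
    rcases (lt_add_one_iff.1 hd).eq_or_lt with rfl | hd
    · exact dvd_mul_left _ _
    · exact (h d hd hd').mul_right k

theorem dvd_of_dvd_add {a x y : A.M} (h : a ∣ x + y) (h' : a ∣ y) : a ∣ x := by
  obtain ⟨u, rfl⟩ := h'
  obtain ⟨w, hw⟩ := h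
  rcases lt_or_ge w u with hlt | hle
  · obtain ⟨c, rfl⟩ := lt_iff_exists_add_one.1 hlt
    have : x + a * (c + 1) + a * w = 0 + a * w := by
      rw [zero_add]
      exact Eq.trans (by ring) hw
    have := add_eq_zero.1 (add_right_cancel this)
    rw [this.1]
    exact dvd_zero a
  · obtain ⟨c, rfl⟩ := le_iff_exists_add'.1 hle
    refine ⟨c, add_right_cancel (b := a * u) ?_⟩
    rw [hw]
    ring

/-- The moduli `m (i + 1) + 1` and `m (j + 1) + 1` are coprime if `j - i` divides `m`. -/
theorem dvd_of_dvd_mul_modulus {m i j n : A.M} (hij : i ≠ j)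
    (hm : ∀ d, 0 < d → (i + d = j ∨ j + d = i) → d ∣ m)
    (h : m * (i + 1) + 1 ∣ n * (m * (j + 1) + 1)) : m * (i + 1) + 1 ∣ n := by
  rcases lt_or_gt_of_ne hij with hlt | hlt
  · obtain ⟨c, rfl⟩ := lt_iff_exists_add_one.1 hlt
    obtain ⟨e, rfl⟩ := hm (c + 1) (lt_add_one_iff.2 zero_le) (.inl (by ring))
    -- The Bézout identity `e (i + 1)² b + a = 1 + e (i + 1) (j + 1) a` for the moduli `a`, `b`.
    refine dvd_of_dvd_add (y := ((c + 1) * e * (i + 1) + 1) * (n * e * (i + 1) * (i + c + 1 + 1)))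
      ?_ (dvd_mul_right _ _)
    convert (h.mul_left (e * (i + 1) * (i + 1))).add (dvd_mul_right _ n) using 1
    ring
  · obtain ⟨c, rfl⟩ := lt_iff_exists_add_one.1 hlt
    obtain ⟨e, rfl⟩ := hm (c + 1) (lt_add_one_iff.2 zero_le) (.inr (by ring))
    -- The Bézout identity `e (i + 1)² b + 1 = (e (i + 1) (j + 1) + 1) a`.
    refine dvd_of_dvd_add (y := e * (j + c + 1 + 1) * (j + c + 1 + 1) *
      (n * ((c + 1) * e * (j + 1) + 1))) ?_ (h.mul_left _)
    exact ⟨n * (e * (j + c + 1 + 1) * (j + 1) + 1), by ring⟩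

/-- The set `{i < k : i ∈ X}` has a representation, though not yet a least one. -/
theorem exists_triple (X : ℕ) (k : A.M) :
    ∃ s, IsTriple s ∧ ∀ i, FinMem i s ↔ i < k ∧ i ∈ A.E X := by
  obtain ⟨m, hm, hdvd⟩ := exists_forall_dvd k
  have key : ∃ n, ∀ i, i < k →
      ((∃ q, q < n + 1 ∧ n = (m * (i + 1) + 1) * q) ↔ i < k ∧ i ∈ A.E X) := by
    -- Run through `j < k` and multiply by the modulus of `j` whenever `j` is in the set.
    refine sigma_induction (fun j n => ∀ i, i < k →
      ((∃ q, q < n + 1 ∧ n = (m * (i + 1) + 1) * q) ↔ i < j ∧ i ∈ A.E X)) k ⟨1, fun i _ => ?_⟩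
      fun j ⟨n, hn⟩ => ?_
    · refine iff_of_false ?_ fun h => not_lt_zero h.1
      rintro ⟨q, -, hq⟩
      have h1 : m * (i + 1) + 1 ≤ 1 := by
        rcases eq_zero_or_eq_add_one q with rfl | ⟨r, rfl⟩
        · rw [mul_zero] at hq
          exact (one_ne_zero hq).elim
        · exact le_iff_exists_add'.2 ⟨(m * (i + 1) + 1) * r, hq.trans (by ring)⟩
      rw [add_le_iff_nonpos_left] at h1
      exact h1.not_gt (mul_pos hm (lt_add_one_iff.2 zero_le))
    · simp only [← dvd_iff_bounded] at hn ⊢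
      by_cases hj : j < k ∧ j ∈ A.E X
      · refine ⟨n * (m * (j + 1) + 1), fun i hi => ?_⟩
        rcases eq_or_ne i j with rfl | hij
        · exact iff_of_true (dvd_mul_left _ _) ⟨lt_add_one_iff.2 le_rfl, hj.2⟩
        · rw [lt_add_one_iff, hij.le_iff_lt, ← hn i hi]
          refine ⟨dvd_of_dvd_mul_modulus hij fun d hd h => hdvd d ?_ hd, fun h => h.mul_right _⟩
          rcases h with rfl | rfl
          · exact le_add_self.trans_lt hj.1
          · exact le_add_self.trans_lt hi
      · refine ⟨n, fun i hi => (hn i hi).trans ?_⟩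
        rcases eq_or_ne i j with rfl | hij
        · exact iff_of_false (fun h => lt_irrefl _ h.1) fun h => hj ⟨hi, h.2⟩
        · rw [lt_add_one_iff, hij.le_iff_lt]
  obtain ⟨n, hn⟩ := key
  refine ⟨_, ⟨k, m, n, rfl⟩, fun i => ?_⟩
  rw [finMem_prs, dvd_iff_bounded]
  exact ⟨fun h => (hn i h.1).1 h.2, fun h => ⟨h.1, (hn i h.1).2 h⟩⟩

/-- Every bounded set of the model has a code. -/
theorem exists_isCode (X : ℕ) (k : A.M) :
    ∃ s, IsCode s ∧ ∀ i, FinMem i s ↔ i < k ∧ i ∈ A.E X := by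
  -- Representing this set is a bounded property: elements of `s` are below `s`.
  have key : ∀ s : A.M, (∀ i, i < s + k → (FinMem i s ↔ i < k ∧ i ∈ A.E X)) ↔
      ∀ i, FinMem i s ↔ i < k ∧ i ∈ A.E X := by
    refine fun s => ⟨fun h i => ?_, fun h i _ => h i⟩
    rcases lt_or_ge i (s + k) with hi | hi
    · exact h i hi
    · exact iff_of_false (fun h => h.lt.not_ge (le_self_add.trans hi))
        fun h => h.1.not_ge (le_add_self.trans hi)
  obtain ⟨s₀, h₀, h₀'⟩ := exists_triple X k
  obtain ⟨s, ⟨hs, hs'⟩, hmin⟩ := exists_least (fun s : A.M =>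
    (∃ k, k < s + 1 ∧ ∃ m, m < s + 1 ∧ ∃ n, n < s + 1 ∧ s = prs k (prs m n)) ∧
      ∀ i, i < s + k → (FinMem i s ↔ i < k ∧ i ∈ A.E X))
    ⟨isTriple_iff_bounded.1 h₀, (key s₀).2 h₀'⟩
  rw [key] at hs'
  refine ⟨s, ⟨isTriple_iff_bounded.2 hs, fun s' h h' => hmin s' h.1 ⟨isTriple_iff_bounded.1 h.2,
    (key s').2 fun i => (h' i).trans (hs' i)⟩⟩, hs'⟩

/-- Every bounded predicate, restricted to a proper initial segment, has a code. -/
theorem exists_code (R : A.M → Prop) (k : A.M) (hR : Delta0 fun x => R x := by exact .auto) :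
    ∃ s, IsCode s ∧ ∀ i, FinMem i s ↔ i < k ∧ R i := by
  obtain ⟨X, hX⟩ := comprehension R hR
  simpa only [hX] using exists_isCode X k

end Coding

/-! ### Finite sequences and paths -/

section Sequences

variable {A : Interp} [IsModel A]

/-- `s` codes a finite sequence of elements of `{0, 1}`. -/
structure IsBits (s : A.M) : Prop where
  isCode : IsCode s
  pairs : ∀ x, FinMem x s → ∃ i v, x = prs i v
  unique : ∀ i v w, FinMem (prs i v) s ∧ FinMem (prs i w) s → v = w
  domain : ∃ l, ∀ i, i < l ↔ ∃ v, FinMem (prs i v) s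
  binary : ∀ i v, FinMem (prs i v) s → v = 0 ∨ v = 1

theorem FinMem.left_lt {i v s : A.M} (h : FinMem (prs i v) s) : i < s :=
  (left_le_prs i v).trans_lt h.lt

theorem FinMem.right_lt {i v s : A.M} (h : FinMem (prs i v) s) : v < s :=
  (right_le_prs i v).trans_lt h.lt

theorem isCode_iff_bounded {s : A.M} : IsCode s ↔
    (∃ k, k < s + 1 ∧ ∃ m, m < s + 1 ∧ ∃ n, n < s + 1 ∧ s = prs k (prs m n)) ∧
      ∀ r, r < s → (∃ k, k < r + 1 ∧ ∃ m, m < r + 1 ∧ ∃ n, n < r + 1 ∧ r = prs k (prs m n)) →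
        ¬∀ i, i < s → (FinMem i r ↔ FinMem i s) := by
  simp only [← isTriple_iff_bounded]
  refine and_congr_right fun _ => forall_congr' fun r => ?_
  rw [and_imp]
  refine forall_congr' fun hr => imp_congr_right fun _ => not_congr ?_
  exact ⟨fun h i _ => h i, fun h i => ⟨fun hi => (h i (hi.lt.trans hr)).1 hi,
    fun hi => (h i hi.lt).2 hi⟩⟩

theorem isBits_iff_bounded {s : A.M} : IsBits s ↔
    ((∃ k, k < s + 1 ∧ ∃ m, m < s + 1 ∧ ∃ n, n < s + 1 ∧ s = prs k (prs m n)) ∧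
      ∀ r, r < s → (∃ k, k < r + 1 ∧ ∃ m, m < r + 1 ∧ ∃ n, n < r + 1 ∧ r = prs k (prs m n)) →
        ¬∀ i, i < s → (FinMem i r ↔ FinMem i s)) ∧
    (∀ x, x < s → FinMem x s → ∃ i, i < s ∧ ∃ v, v < s ∧ x = prs i v) ∧
    (∀ i, i < s → ∀ v, v < s → ∀ w, w < s → FinMem (prs i v) s ∧ FinMem (prs i w) s → v = w) ∧
    (∃ l, l < s + 1 ∧ ∀ i, i < s → (i < l ↔ ∃ v, v < s ∧ FinMem (prs i v) s)) ∧
    ∀ i, i < s → ∀ v, v < s → FinMem (prs i v) s → v = 0 ∨ v = 1 := by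
  rw [← isCode_iff_bounded]
  constructor
  · rintro ⟨h₁, h₂, h₃, ⟨l, hl⟩, h₅⟩
    refine ⟨h₁, fun x _ hx => ?_, fun i _ v _ w _ => h₃ i v w, ⟨l, ?_, fun i _ => ?_⟩,
      fun i _ v _ => h₅ i v⟩
    · obtain ⟨i, v, rfl⟩ := h₂ x hx
      exact ⟨i, hx.left_lt, v, hx.right_lt, rfl⟩
    · rw [lt_add_one_iff]
      by_contra! hs
      obtain ⟨v, hv⟩ := (hl s).1 hs
      exact hv.left_lt.false
    · exact (hl i).trans (exists_congr fun v => ⟨fun h => ⟨h.right_lt, h⟩, fun h => h.2⟩)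
  · rintro ⟨h₁, h₂, h₃, ⟨l, hls, hl⟩, h₅⟩
    refine ⟨h₁, fun x hx => ?_, fun i v w h => ?_, ⟨l, fun i => ⟨fun hi => ?_, ?_⟩⟩,
      fun i v h => h₅ i h.left_lt v h.right_lt h⟩
    · obtain ⟨i, _, v, _, h⟩ := h₂ x hx.lt hx
      exact ⟨i, v, h⟩
    · exact h₃ i h.1.left_lt v h.1.right_lt w h.2.right_lt h
    · obtain ⟨v, _, hv⟩ := (hl i (hi.trans_le (lt_add_one_iff.1 hls))).1 hi
      exact ⟨v, hv⟩
    · rintro ⟨v, hv⟩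
      exact (hl i hv.left_lt).2 ⟨v, hv.right_lt, hv⟩

theorem Delta0.isBits : Delta0 fun s : A.M => IsBits s :=
  .of_iff .auto fun _ => isBits_iff_bounded

variable (v : ℕ → A.M) (ρ : ℕ → ℕ)

theorem sat_finMem (i s : Tm) :
    (finMem i s).Sat A v ρ ↔ FinMem (i.val A v) (s.val A v) := by
  simp only [finMem, dvd, Fm.sat_exN, Fm.sat_and, Fm.Sat, Tm.val, pair, Tm.up, Tm.val_subst]
  constructor
  · rintro ⟨k, m, n, h, hi, q, hq⟩
    have h : s.val A v = prs k (prs m n) := h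
    rw [h, finMem_prs]
    exact ⟨hi, q, hq⟩
  · rintro ⟨k, -, m, -, n, -, h, hi, q, -, hq⟩
    exact ⟨k, m, n, h, hi, q, hq⟩

theorem sat_isFinSetCode (s : Tm) : (isFinSetCode s).Sat A v ρ ↔ IsCode (s.val A v) := by
  simp only [isFinSetCode, isTriple, Fm.sat_and, Fm.sat_neg, Fm.sat_iff, Fm.sat_exN,
    sat_finMem, Fm.Sat, Tm.up, Tm.val_subst]
  rfl

theorem sat_isBinSeq (s : Tm) : (isBinSeq s).Sat A v ρ ↔ IsBits (s.val A v) := by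
  simp only [isBinSeq, isSeq, Fm.sat_and, Fm.sat_iff, Fm.sat_or, Fm.sat_exN, sat_finMem,
    sat_isFinSetCode, Fm.Sat, Tm.up, Tm.val_subst]
  constructor
  · rintro ⟨⟨h₁, h₂, h₃, h₄⟩, h₅⟩
    exact ⟨h₁, h₂, h₃, h₄, h₅⟩
  · rintro ⟨h₁, h₂, h₃, h₄, h₅⟩
    exact ⟨⟨h₁, h₂, h₃, h₄⟩, h₅⟩

/-- Weak König's lemma in the model. -/
theorem exists_path (T : ℕ) (bits : ∀ s, s ∈ A.E T → IsBits s)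
    (closed : ∀ s t, s ∈ A.E T → IsBits t → (∀ x, FinMem x t → FinMem x s) → t ∈ A.E T)
    (infinite : ∀ n, ∃ s, n < s ∧ s ∈ A.E T) :
    ∃ F, (∀ i, ∃ v, prs i v ∈ A.E F) ∧
      ∀ n, ∃ s, s ∈ A.E T ∧ ∀ i v, FinMem (prs i v) s ↔ i < n ∧ prs i v ∈ A.E F := by
  have h := IsModel.models (A := A) weakKonigLemma (.inr rfl) (fun _ => 0) id
  simp only [weakKonigLemma, isBinTree, isInfinite, isPath, isFunction, isInitialSegment,
    isRestriction, Fm.sat_allS, Fm.sat_exS, Fm.sat_and, Fm.sat_iff, Fm.sat_exN,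
    sat_finMem, sat_isBinSeq, Fm.Sat] at h
  obtain ⟨F, ⟨-, hF, -⟩, hT⟩ := h T ⟨⟨bits, fun s t h => closed s t h.1 h.2.1 h.2.2⟩, infinite⟩
  refine ⟨F, hF, fun n => (hT n).imp fun s ⟨hs, h⟩ => ⟨hs, fun i v => (h (prs i v)).trans ?_⟩⟩
  constructor
  · rintro ⟨j, w, hj, hjw, hF⟩
    obtain ⟨rfl, rfl⟩ := prs_inj.1 hjw
    exact ⟨hj, hF⟩
  · rintro ⟨hi, hF⟩
    exact ⟨i, v, hi, rfl, hF⟩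

end Sequences

/-! ### Counting the elements of a set -/

section Counting

variable {A : Interp} {D : ℕ}

/-- The finite set coded by `s` is, up to `x`, the graph of the function `i ↦ #{d ∈ D : d < i}`. -/
structure Counts (D : ℕ) (x s : A.M) : Prop where
  zero : FinMem (prs 0 0) s
  step : ∀ i, i < x → ∀ c, c < s → FinMem (prs i c) s →
    (i ∈ A.E D → FinMem (prs (i + 1) (c + 1)) s) ∧ (i ∉ A.E D → FinMem (prs (i + 1) c) s)
  unique : ∀ i, i < x + 1 → ∀ c, c < s → ∀ c', c' < s →
    FinMem (prs i c) s → FinMem (prs i c') s → c = c'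

theorem counts_iff {x s : A.M} : Counts D x s ↔
    FinMem (prs 0 0) s ∧ (∀ i, i < x → ∀ c, c < s → FinMem (prs i c) s →
    (i ∈ A.E D → FinMem (prs (i + 1) (c + 1)) s) ∧ (i ∉ A.E D → FinMem (prs (i + 1) c) s)) ∧
    ∀ i, i < x + 1 → ∀ c, c < s → ∀ c', c' < s →
      FinMem (prs i c) s → FinMem (prs i c') s → c = c' :=
  ⟨fun ⟨h₁, h₂, h₃⟩ => ⟨h₁, h₂, h₃⟩, fun ⟨h₁, h₂, h₃⟩ => ⟨h₁, h₂, h₃⟩⟩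

variable [IsModel A]

theorem Delta0.counts {α : Type} [Ctx A α] {f g : α → A.M} (hf : TermFun f) (hg : TermFun g) :
    Delta0 fun c => Counts D (f c) (g c) :=
  .comp₂ (.of_iff .auto fun _ => counts_iff) hf hg

namespace Counts

theorem next {x s i c : A.M} (h : Counts D x s) (hi : i < x) (hc : FinMem (prs i c) s) :
    ∃ c', FinMem (prs (i + 1) c') s ∧ (i ∈ A.E D → c' = c + 1) ∧ (i ∉ A.E D → c' = c) := by
  by_cases hD : i ∈ A.E D
  · exact ⟨c + 1, (h.step i hi c hc.right_lt hc).1 hD, fun _ => rfl, fun h => (h hD).elim⟩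
  · exact ⟨c, (h.step i hi c hc.right_lt hc).2 hD, fun h => (hD h).elim, fun _ => rfl⟩

theorem eq {x s i c c' : A.M} (h : Counts D x s) (hi : i ≤ x) (hc : FinMem (prs i c) s)
    (hc' : FinMem (prs i c') s) : c = c' :=
  h.unique i (lt_add_one_iff.2 hi) c hc.right_lt c' hc'.right_lt hc hc'

theorem mono {x y s : A.M} (h : Counts D x s) (hy : y ≤ x) : Counts D y s where
  zero := h.zero
  step i hi := h.step i (hi.trans_le hy)
  unique i hi := h.unique i (hi.trans_le (add_le_add_left hy 1))

theorem exists_common {x s s' : A.M} (h : Counts D x s) (h' : Counts D x s') :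
    ∃ c, FinMem (prs x c) s ∧ FinMem (prs x c) s' := by
  have key : x ≤ x → ∃ c, c < s ∧ FinMem (prs x c) s ∧ FinMem (prs x c) s' := by
    refine induction (fun i => i ≤ x → ∃ c, c < s ∧ FinMem (prs i c) s ∧ FinMem (prs i c) s') x
      (fun _ => ⟨0, h.zero.right_lt, h.zero, h'.zero⟩) fun i ih hi => ?_
    have hi := add_one_le_iff.1 hi
    obtain ⟨c, -, hc, hc'⟩ := ih hi.le
    obtain ⟨d, hd, h₁, h₂⟩ := h.next hi hc
    obtain ⟨d', hd', h₁', h₂'⟩ := h'.next hi hc'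
    have : d = d' := by
      by_cases hD : i ∈ A.E D
      · rw [h₁ hD, h₁' hD]
      · rw [h₂ hD, h₂' hD]
    exact ⟨d, hd.right_lt, hd, this ▸ hd'⟩
  obtain ⟨c, -, hc⟩ := key le_rfl
  exact ⟨c, hc⟩

theorem agree {x s s' c : A.M} (h : Counts D x s) (h' : Counts D x s')
    (hc : FinMem (prs x c) s) : FinMem (prs x c) s' := by
  obtain ⟨d, hd, hd'⟩ := h.exists_common h'
  rwa [h.eq le_rfl hc hd]

end Counts

theorem exists_counts (D : ℕ) (x : A.M) : ∃ s, Counts D x s := by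
  refine sigma_induction (fun x s => Counts D x s) x ?_ ?_ (.counts (.proj (.fst .id)) (.snd .id))
  · obtain ⟨s, -, hs⟩ := exists_code (fun y : A.M => y = prs 0 0) (prs 0 0 + 1)
    have hmem : ∀ i c, FinMem (prs i c) s ↔ i = 0 ∧ c = 0 := fun i c => by
      rw [hs, prs_inj]
      refine and_iff_right_of_imp fun h => ?_
      rw [h.1, h.2]
      exact lt_add_one_iff.2 le_rfl
    refine ⟨s, (hmem _ _).2 ⟨rfl, rfl⟩, fun i hi => (not_lt_zero hi).elim, ?_⟩
    intro i _ c _ c' _ hc hc'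
    rw [((hmem _ _).1 hc).2, ((hmem _ _).1 hc').2]
  · rintro x ⟨s, h⟩
    obtain ⟨c, hc, -⟩ := h.exists_common h
    obtain ⟨c', h₁, h₂⟩ : ∃ c', (x ∈ A.E D → c' = c + 1) ∧ (x ∉ A.E D → c' = c) := by
      by_cases hD : x ∈ A.E D
      · exact ⟨c + 1, fun _ => rfl, fun h => (h hD).elim⟩
      · exact ⟨c, fun h => (hD h).elim, fun _ => rfl⟩
    obtain ⟨s', -, hs'⟩ := exists_code (fun y => (∃ i, i < x + 1 ∧ ∃ c, c < s ∧ y = prs i c ∧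
      FinMem y s) ∨ y = prs (x + 1) c') (s + prs (x + 1) c' + 1)
    have hmem : ∀ i e, FinMem (prs i e) s' ↔
        i ≤ x ∧ FinMem (prs i e) s ∨ i = x + 1 ∧ e = c' := by
      intro i e
      rw [hs', prs_inj, lt_add_one_iff]
      constructor
      · rintro ⟨-, ⟨j, hj, d, -, hjd, hs⟩ | h⟩
        · obtain ⟨rfl, rfl⟩ := prs_inj.1 hjd
          exact .inl ⟨lt_add_one_iff.1 hj, hs⟩
        · exact .inr h
      · rintro (⟨hi, hs⟩ | ⟨rfl, rfl⟩)
        · exact ⟨hs.lt.le.trans le_self_add,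
            .inl ⟨i, lt_add_one_iff.2 hi, e, hs.right_lt, rfl, hs⟩⟩
        · exact ⟨le_add_self, .inr ⟨rfl, rfl⟩⟩
    refine ⟨s', (hmem _ _).2 (.inl ⟨zero_le, h.zero⟩), fun i hi e _ he => ?_,
      fun i hi e _ e' _ he he' => ?_⟩
    · have hix := lt_add_one_iff.1 hi
      obtain ⟨-, he⟩ := ((hmem _ _).1 he).resolve_right fun h => hi.ne h.1
      rcases hix.eq_or_lt with rfl | hix
      · obtain rfl := h.eq le_rfl hc he
        exact ⟨fun hD => (hmem _ _).2 (.inr ⟨rfl, (h₁ hD).symm⟩),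
          fun hD => (hmem _ _).2 (.inr ⟨rfl, (h₂ hD).symm⟩)⟩
      · have := h.step i hix e he.right_lt he
        exact ⟨fun hD => (hmem _ _).2 (.inl ⟨add_one_le_iff.2 hix, this.1 hD⟩),
          fun hD => (hmem _ _).2 (.inl ⟨add_one_le_iff.2 hix, this.2 hD⟩)⟩
    · rcases (hmem _ _).1 he with ⟨hi, he⟩ | ⟨rfl, rfl⟩
      · obtain ⟨-, he'⟩ := ((hmem _ _).1 he').resolve_right
          fun h => (lt_add_one_iff.2 hi).ne h.1
        exact h.eq hi he he'
      · exact (((hmem _ _).1 he').resolve_left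
          fun h => (lt_add_one_iff.2 le_rfl).not_ge h.1).2.symm

/-- The counting function of a set exists as a set of pairs. -/
theorem exists_counting_function (D : ℕ) : ∃ C : ℕ, prs 0 0 ∈ A.E C ∧
    (∀ x n, prs x n ∈ A.E C → (x ∈ A.E D → prs (x + 1) (n + 1) ∈ A.E C) ∧
      (x ∉ A.E D → prs (x + 1) n ∈ A.E C)) ∧
    (∀ x, ∃ n, prs x n ∈ A.E C) ∧
    ∀ x n n', prs x n ∈ A.E C → prs x n' ∈ A.E C → n = n' := by
  obtain ⟨C, hC⟩ := delta_comprehension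
    (R := fun y : A.M => ∃ s, ∃ x, x < y + 1 ∧ ∃ n, n < y + 1 ∧ y = prs x n ∧ Counts D x s ∧
      FinMem y s)
    (Q := fun y s => ∃ x, x < y + 1 ∧ ∃ n, n < y + 1 ∧ y = prs x n ∧ Counts D x s ∧ FinMem y s)
    (Q' := fun y s => ∃ x, x < y + 1 ∧ ∃ n, n < y + 1 ∧ y = prs x n ∧
      (Counts D x s → FinMem y s))
    (fun y => Iff.rfl)
    (fun y => by
      constructor
      · rintro ⟨s, x, hx, n, hn, rfl, hs, h⟩ s'
        exact ⟨x, hx, n, hn, rfl, fun hs' => hs.agree hs' h⟩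
      · intro h
        obtain ⟨x, hx, n, hn, rfl, -⟩ := h 0
        obtain ⟨s, hs⟩ := exists_counts D x
        refine ⟨s, x, hx, n, hn, rfl, hs, ?_⟩
        obtain ⟨x', -, n', -, hxn, h⟩ := h s
        obtain ⟨rfl, rfl⟩ := prs_inj.1 hxn
        exact h hs)
    (.bex (.add (.proj (.fst .id)) .one) <| .bex (.add (.proj (.fst (.fst .id))) .one) <|
      .and .auto <| .and (.counts (.snd (.fst .id)) (.snd (.fst (.fst .id)))) .auto)
    (.bex (.add (.proj (.fst .id)) .one) <| .bex (.add (.proj (.fst (.fst .id))) .one) <|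
      .and .auto <| .imp (.counts (.snd (.fst .id)) (.snd (.fst (.fst .id)))) .auto)
  have key : ∀ x n, prs x n ∈ A.E C ↔ ∃ s, Counts D x s ∧ FinMem (prs x n) s := by
    intro x n
    rw [hC]
    constructor
    · rintro ⟨s, x', -, n', -, hxn, h⟩
      obtain ⟨rfl, rfl⟩ := prs_inj.1 hxn
      exact ⟨s, h⟩
    · rintro ⟨s, h⟩
      exact ⟨s, x, lt_add_one_iff.2 (left_le_prs _ _), n, lt_add_one_iff.2 (right_le_prs _ _),
        rfl, h⟩
  refine ⟨C, ?_⟩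
  simp only [key]
  refine ⟨?_, fun x n ⟨s, hs, h⟩ => ?_, fun x => ?_, fun x n n' ⟨s, hs, h⟩ ⟨s', hs', h'⟩ => ?_⟩
  · obtain ⟨s, hs⟩ := exists_counts (A := A) D 0
    exact ⟨s, hs, hs.zero⟩
  · obtain ⟨s', hs'⟩ := exists_counts D (x + 1)
    have h' := hs.agree (hs'.mono le_self_add) h
    have := hs'.step x (lt_add_one_iff.2 le_rfl) n h'.right_lt h'
    exact ⟨fun hD => ⟨s', hs', this.1 hD⟩, fun hD => ⟨s', hs', this.2 hD⟩⟩
  · obtain ⟨s, hs⟩ := exists_counts D x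
    obtain ⟨n, hn, -⟩ := hs.exists_common hs
    exact ⟨n, s, hs, hn⟩
  · exact hs.eq le_rfl h (hs'.agree hs h')

/-- Diagonalization inside an infinite set `D`: the `n`-th element of `D` is put into the set to be
constructed if and only if it is not in the `n`-th set of the sequence `Z`. -/
theorem exists_diagonal (D Z : ℕ) (hD : ∀ n : A.M, ∃ x, n < x ∧ x ∈ A.E D) :
    ∃ B, ∀ n : A.M, ∃ d, d ∈ A.E D ∧ (d ∈ A.E B ↔ prs d n ∉ A.E Z) := by
  obtain ⟨C, hzero, hstep, htotal, hunique⟩ := exists_counting_function (A := A) D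
  have hnext : ∀ x n, prs x n ∈ A.E C → ∃ d, d ∈ A.E D ∧ prs d n ∈ A.E C := by
    intro x n hx
    obtain ⟨d₀, hd₀, hd₀D⟩ := hD x
    obtain ⟨d, ⟨hdD, hxd⟩, hmin⟩ :=
      exists_least (fun d => d ∈ A.E D ∧ x ≤ d) ⟨hd₀D, hd₀.le⟩
    obtain ⟨y, rfl⟩ := le_iff_exists_add'.1 hxd
    refine ⟨x + y, hdD, ?_⟩
    have : y ≤ y → prs (x + y) n ∈ A.E C := by
      refine induction (fun z => z ≤ y → prs (x + z) n ∈ A.E C) y (fun _ => by rwa [add_zero])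
        fun z ih hz => ?_
      have hz := add_one_le_iff.1 hz
      rw [← add_assoc]
      exact (hstep _ _ (ih hz.le)).2 fun h =>
        hmin (x + z) (add_lt_add_right hz x) ⟨h, le_self_add⟩
    exact this le_rfl
  have hsurj : ∀ n, ∃ d, d ∈ A.E D ∧ prs d n ∈ A.E C := fun n =>
    sigma_induction (fun n d => d ∈ A.E D ∧ prs d n ∈ A.E C) n (hnext 0 0 hzero)
      fun n ⟨d, hd, hdn⟩ => hnext (d + 1) (n + 1) ((hstep d n hdn).1 hd)
  obtain ⟨B, hB⟩ := delta_comprehension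
    (R := fun d : A.M => ∃ n, prs d n ∈ A.E C ∧ prs d n ∉ A.E Z)
    (Q := fun d n => prs d n ∈ A.E C ∧ prs d n ∉ A.E Z)
    (Q' := fun d n => prs d n ∈ A.E C → prs d n ∉ A.E Z) (fun _ => Iff.rfl) fun d => by
      constructor
      · rintro ⟨n, hn, hZ⟩ n' hn'
        rwa [hunique d n' n hn' hn]
      · intro h
        obtain ⟨n, hn⟩ := htotal d
        exact ⟨n, hn, h n hn⟩
  refine ⟨B, fun n => ?_⟩
  obtain ⟨d, hd, hdn⟩ := hsurj n
  refine ⟨d, hd, (hB d).trans ⟨?_, fun h => ⟨n, hdn, h⟩⟩⟩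
  rintro ⟨n', hn', h⟩
  rwa [hunique d n n' hdn hn']

end Counting

/-! ### Initial intervals with a prescribed trace on an antichain -/

section Intervals

variable {A : Interp} [IsModel A]

/-- The constraints on a finite approximation `s` to the characteristic function of an initial
interval of `P` whose intersection with `D` is `B ∩ D`. -/
structure Approximates (P L D B : ℕ) (s : A.M) : Prop where
  subset : ∀ x, x < s → FinMem (prs x 1) s → x ∈ A.E P
  initial : ∀ x, x < s → ∀ y, y < s → FinMem (prs x 0) s → FinMem (prs y 1) s → prs x y ∉ A.E L
  pos : ∀ d, d < s → FinMem (prs d 1) s → d ∈ A.E D → d ∈ A.E B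
  neg : ∀ d, d < s → FinMem (prs d 0) s → d ∈ A.E D → d ∉ A.E B

variable {P L D B : ℕ}

theorem Approximates.mono {s t : A.M} (h : Approximates P L D B s)
    (hts : ∀ x, FinMem x t → FinMem x s) : Approximates P L D B t where
  subset x _ hx := h.subset x (hts _ hx).left_lt (hts _ hx)
  initial x _ y _ hx hy :=
    h.initial x (hts _ hx).left_lt y (hts _ hy).left_lt (hts _ hx) (hts _ hy)
  pos d _ hd := h.pos d (hts _ hd).left_lt (hts _ hd)
  neg d _ hd := h.neg d (hts _ hd).left_lt (hts _ hd)

theorem Delta0.approximates : Delta0 fun s : A.M => Approximates P L D B s :=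
  (Delta0.auto (R := fun s : A.M => (∀ x, x < s → FinMem (prs x 1) s → x ∈ A.E P) ∧
    (∀ x, x < s → ∀ y, y < s → FinMem (prs x 0) s → FinMem (prs y 1) s → prs x y ∉ A.E L) ∧
    (∀ d, d < s → FinMem (prs d 1) s → d ∈ A.E D → d ∈ A.E B) ∧
    ∀ d, d < s → FinMem (prs d 0) s → d ∈ A.E D → d ∉ A.E B)).of_iff fun _ =>
  ⟨fun ⟨h₁, h₂, h₃, h₄⟩ => ⟨h₁, h₂, h₃, h₄⟩, fun ⟨h₁, h₂, h₃, h₄⟩ => ⟨h₁, h₂, h₃, h₄⟩⟩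

/-- The tree of approximations is infinite. -/
theorem exists_approximation
    (hLP : ∀ x y : A.M, prs x y ∈ A.E L → x ∈ A.E P)
    (hDrefl : ∀ d : A.M, d ∈ A.E D → prs d d ∈ A.E L)
    (htrans : ∀ x y z : A.M, prs x y ∈ A.E L → prs y z ∈ A.E L → prs x z ∈ A.E L)
    (hanti : ∀ x y : A.M, x ∈ A.E D → y ∈ A.E D → prs x y ∈ A.E L → x = y) (l : A.M) :
    ∃ s, l < s ∧ IsBits s ∧ Approximates P L D B s := by
  -- The downward closure of the part of `B ∩ D` below `l + 1`.
  obtain ⟨J, hJ⟩ := comprehension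
    fun x : A.M => ∃ d, d < l + 1 ∧ d ∈ A.E B ∧ d ∈ A.E D ∧ prs x d ∈ A.E L
  obtain ⟨s, hs, hmem⟩ := exists_code (fun y => ∃ x, x < l + 1 ∧
    (x ∈ A.E J ∧ y = prs x 1 ∨ x ∉ A.E J ∧ y = prs x 0)) (prs (l + 1) 1 + 1)
  have hbit : ∀ x v, FinMem (prs x v) s ↔
      x < l + 1 ∧ (x ∈ A.E J ∧ v = 1 ∨ x ∉ A.E J ∧ v = 0) := by
    intro x v
    rw [hmem]
    constructor
    · rintro ⟨-, z, hz, ⟨hJ, h⟩ | ⟨hJ, h⟩⟩ <;> obtain ⟨rfl, rfl⟩ := prs_inj.1 h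
      · exact ⟨hz, .inl ⟨hJ, rfl⟩⟩
      · exact ⟨hz, .inr ⟨hJ, rfl⟩⟩
    · rintro ⟨hx, ⟨hJ, rfl⟩ | ⟨hJ, rfl⟩⟩
      · exact ⟨lt_add_one_iff.2 (prs_le_prs hx.le le_rfl), x, hx, .inl ⟨hJ, rfl⟩⟩
      · exact ⟨lt_add_one_iff.2 (prs_le_prs hx.le zero_le), x, hx, .inr ⟨hJ, rfl⟩⟩
  have hone : ∀ x, FinMem (prs x 1) s ↔ x < l + 1 ∧ x ∈ A.E J := fun x => by
    simp [hbit]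
  have hzero : ∀ x, FinMem (prs x 0) s ↔ x < l + 1 ∧ x ∉ A.E J := fun x => by
    simp [hbit]
  have htot : ∀ x, x < l + 1 → ∃ v, FinMem (prs x v) s := fun x hx => by
    by_cases h : x ∈ A.E J
    · exact ⟨1, (hone x).2 ⟨hx, h⟩⟩
    · exact ⟨0, (hzero x).2 ⟨hx, h⟩⟩
  refine ⟨s, ?_, ⟨hs, ?_, ?_, ⟨l + 1, fun x => ⟨htot x, fun ⟨v, hv⟩ => ((hbit _ _).1 hv).1⟩⟩, ?_⟩,
    ⟨?_, ?_, ?_, ?_⟩⟩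
  · obtain ⟨v, hv⟩ := htot l (lt_add_one_iff.2 le_rfl)
    exact hv.left_lt
  · intro y hy
    obtain ⟨-, x, -, ⟨-, h⟩ | ⟨-, h⟩⟩ := (hmem y).1 hy
    exacts [⟨x, 1, h⟩, ⟨x, 0, h⟩]
  · rintro x v w ⟨hv, hw⟩
    obtain ⟨-, ⟨h, rfl⟩ | ⟨h, rfl⟩⟩ := (hbit _ _).1 hv <;>
      obtain ⟨-, ⟨h', rfl⟩ | ⟨h', rfl⟩⟩ := (hbit _ _).1 hw
    exacts [rfl, (h' h).elim, (h h').elim, rfl]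
  · intro x v hv
    exact ((hbit _ _).1 hv).2.symm.imp (fun h => h.2) fun h => h.2
  · intro x _ hx
    obtain ⟨d, -, -, -, h⟩ := (hJ x).1 ((hone x).1 hx).2
    exact hLP x d h
  · intro x _ y _ hx hy hxy
    obtain ⟨d, hd, hB, hD, hyd⟩ := (hJ y).1 ((hone y).1 hy).2
    exact ((hzero x).1 hx).2 ((hJ x).2 ⟨d, hd, hB, hD, htrans x y d hxy hyd⟩)
  · intro x _ hx hxD
    obtain ⟨d, -, hB, hD, hxd⟩ := (hJ x).1 ((hone x).1 hx).2
    rwa [hanti x d hxD hD hxd]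
  · intro x _ hx hxD hxB
    obtain ⟨hxl, h⟩ := (hzero x).1 hx
    exact h ((hJ x).2 ⟨x, hxl, hxB, hxD, hDrefl x hxD⟩)

/-- For every subset `B` of an antichain `D`, some initial interval meets `D` exactly in `B`. The
downward closure of `B` need not exist as a set of the model; the interval is a path through the
tree of approximations. -/
theorem exists_interval
    (hLP : ∀ x y : A.M, prs x y ∈ A.E L → x ∈ A.E P)
    (hDrefl : ∀ d : A.M, d ∈ A.E D → prs d d ∈ A.E L)
    (htrans : ∀ x y z : A.M, prs x y ∈ A.E L → prs y z ∈ A.E L → prs x z ∈ A.E L)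
    (hanti : ∀ x y : A.M, x ∈ A.E D → y ∈ A.E D → prs x y ∈ A.E L → x = y) :
    ∃ I, (∀ x, x ∈ A.E I → x ∈ A.E P) ∧
      (∀ x y, prs x y ∈ A.E L → y ∈ A.E I → x ∈ A.E I) ∧
      ∀ d, d ∈ A.E D → (d ∈ A.E I ↔ d ∈ A.E B) := by
  obtain ⟨T, hT⟩ := comprehension (fun s : A.M => IsBits s ∧ Approximates P L D B s)
    (Delta0.isBits.and .approximates)
  obtain ⟨F, htot, hF⟩ := exists_path T (fun s hs => ((hT s).1 hs).1)
    (fun s t hs ht hts => (hT t).2 ⟨ht, ((hT s).1 hs).2.mono hts⟩) fun l => by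
      obtain ⟨s, hls, hs⟩ := exists_approximation (B := B) hLP hDrefl htrans hanti l
      exact ⟨s, hls, (hT s).2 hs⟩
  have key : ∀ n : A.M, ∃ s, IsBits s ∧ Approximates P L D B s ∧
      ∀ i v, i < n → prs i v ∈ A.E F → FinMem (prs i v) s := fun n => by
    obtain ⟨s, hs, h⟩ := hF n
    exact ⟨s, ((hT s).1 hs).1, ((hT s).1 hs).2, fun i v hi hv => (h i v).2 ⟨hi, hv⟩⟩
  have hbit : ∀ x, prs x 0 ∈ A.E F ∨ prs x 1 ∈ A.E F := fun x => by
    obtain ⟨v, hv⟩ := htot x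
    obtain ⟨s, hs, -, h⟩ := key (x + 1)
    rcases hs.binary x v (h x v (lt_add_one_iff.2 le_rfl) hv) with rfl | rfl
    exacts [.inl hv, .inr hv]
  obtain ⟨I, hI⟩ := comprehension fun x => prs x 1 ∈ A.E F
  simp only [← hI] at hbit
  refine ⟨I, fun x hx => ?_, fun x y hxy hy => ?_, fun d hd => ⟨fun hdI => ?_, fun hdB => ?_⟩⟩
  · obtain ⟨s, -, hs, h⟩ := key (x + 1)
    have := h x 1 (lt_add_one_iff.2 le_rfl) ((hI x).1 hx)
    exact hs.subset x this.left_lt this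
  · refine (hbit x).resolve_left fun hx => ?_
    obtain ⟨s, -, hs, h⟩ := key (x + y + 1)
    have h₁ := h x 0 (lt_add_one_iff.2 le_self_add) hx
    have h₂ := h y 1 (lt_add_one_iff.2 le_add_self) ((hI y).1 hy)
    exact hs.initial x h₁.left_lt y h₂.left_lt h₁ h₂ hxy
  · obtain ⟨s, -, hs, h⟩ := key (d + 1)
    have := h d 1 (lt_add_one_iff.2 le_rfl) ((hI d).1 hdI)
    exact hs.pos d this.left_lt this hd
  · refine (hbit d).resolve_left fun hd0 => ?_
    obtain ⟨s, -, hs, h⟩ := key (d + 1)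
    have := h d 0 (lt_add_one_iff.2 le_rfl) hd0
    exact hs.neg d this.left_lt this hd hdB

theorem sat_countableIntervalsNoInfiniteAntichain (v : ℕ → A.M) (ρ : ℕ → ℕ) :
    countableIntervalsNoInfiniteAntichain.Sat A v ρ := by
  simp only [countableIntervalsNoInfiniteAntichain, isPartialOrder, countablyManyInitialIntervals,
    isInitialInterval, hasInfiniteAntichain, isAntichain, isInfinite, Fm.sat_allS, Fm.sat_exS,
    Fm.sat_and, Fm.sat_or, Fm.sat_allN, Fm.sat_imp, Fm.sat_iff, Fm.sat_neg, Fm.sat_exN]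
  rintro P L ⟨⟨hsub, hrefl, -, htrans⟩, Z, hZ⟩ ⟨D, ⟨hDP, hanti⟩, hinf⟩
  obtain ⟨B, hB⟩ := exists_diagonal D Z hinf
  obtain ⟨I, hIP, hI, hID⟩ := exists_interval (P := P) (L := L) (D := D) (B := B)
    (fun x y hxy => by
      obtain ⟨x', y', hx', -, h⟩ := hsub _ hxy
      obtain ⟨rfl, rfl⟩ := prs_inj.1 h
      exact hx')
    (fun d hd => hrefl d (hDP d hd)) (fun x y z h h' => htrans x y z ⟨h, h'⟩)
    (fun x y hx hy hxy => by_contra fun hne => hanti x y ⟨hx, hy, hne⟩ (.inl hxy))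
  obtain ⟨n, hn⟩ := hZ I ⟨hIP, fun x y ⟨_, _, hxy, hy⟩ => hI x y hxy hy⟩
  have hn : ∀ x, x ∈ A.E I ↔ prs x n ∈ A.E Z := hn
  obtain ⟨d, hd, hdB⟩ := hB n
  rw [← hID d hd, hn] at hdB
  exact iff_not_self hdB

end Intervals

end SecondOrderArith

theorem theorem5p10 :
    SecondOrderArith.Proves SecondOrderArith.WKL0
      SecondOrderArith.countableIntervalsNoInfiniteAntichain :=
  SecondOrderArith.proves_of_models SecondOrderArith.substClosed_WKL0 _ fun _ hc hm v ρ =>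
    have := SecondOrderArith.IsModel.mk hm hc
    SecondOrderArith.sat_countableIntervalsNoInfiniteAntichain v ρ
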